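/- Let $t_n := 1-(n+1)^{-2}$ for $n\in\mathbb N=\{0,1,2,\dots\}$. For an integer $\lambda\ge 2$ let $\mathcal Q(\lambda)$ be the family of open squares $Q\subset[0,1]^2$ of side $\lambda^{-1}$ with vertices in $\lambda^{-1}\mathbb Z^2$, and let $r(Q)$ be the lower left corner of $Q$. **Quasi-self-similar family.** Let $N>1$ and let $(V_i,\Theta_i)$, $i=1,\dots,N$, be such that: (i) $V_i\in C^\infty([0,1]^2\times[0,1];\mathbb R^2)$ is divergence free and tangent to $\partial[0,1]^2$; (ii) $\Theta_i\in C^\infty([0,1]^2\times[0,1])$ is non-constant, with $\int_{(0,1)^2}\Theta_i(x,t)\,dx=0$ and $\int_{(0,1)^2}\Theta_i(x,t)^2\,dx=1$ for every $t\in[0,1]$; (iii) $\partial_t\Theta_i+V_i\cdot\nabla\Theta_i=0$; (iv) for every $Q\in\mathcal Q(5)$ there is $j$ with $\Theta_i(x,1)=\Theta_j(5(x-r(Q)),0)$ for $x\in Q$. Let $\{(\rho_n,v_n)\}_{n\in\mathbb N}$ be smooth solutions on $\mathbb T^2\times[0,1]$ ($\mathbb T^2=\mathbb R^2/\mathbb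 Z^2$) of $\partial_t\rho_n+v_n\cdot\nabla\rho_n=0$, $\operatorname{div}v_n=0$, such that for every $n$ and every $Q\in\mathcal Q(2\cdot5^n)$ there is an index $i(Q)$ with $$\rho_n(x,t)=\Theta_{i(Q)}(2\cdot5^n(x-r(Q)),t),\qquad v_n(x,t)=\tfrac1{2\cdot5^n}V_{i(Q)}(2\cdot5^n(x-r(Q)),t)\qquad (x\in Q,\ t\in[0,1]),$$ such that $\rho_n(\cdot,1)=\rho_{n+1}(\cdot,0)$, and such that for each $n$, in the unit cell, $\rho_n(\cdot,t)$ and $v_n(\cdot,t)$ vanish outside a compact set $K_n\subset(0,1)^2$ for all $t\in[0,1]$. **Time change.** Let $\eta:[0,1]\to[0,1]$ be non-decreasing, smooth on $[0,1)$, with $\eta(t_n)=t_n$, $\eta^{(k)}(t_n)=0$ for all $n\ge0$, $k\ge1$, and, for every $k\ge 0$, $|\eta^{(k)}(t)|\le C(k)(n+1)^{5k}$ for all $n\ge0$ and $t\in[t_n,t_{n+1})$. **Velocity fields.** Define on $\mathbb T^2\times[0,1]$, for integers $m\ge2$, $$v^m(x,t)=\sum_{n=0}^m\eta'(t)\,\chi_{[t_n,t_{n+1})}(\eta(t))\,\frac1{t_{n+1}-t_n}\,v_n\Big(x,\frac{\eta(t)-t_n}{t_{n+1}-t_n}\Big),$$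 let $v$ be given by the same formula with the sum over all $n\ge0$ (so that $v^m(\cdot,1)=v(\cdot,1)=0$), and set $$\nu_m=m^{10}5^{-2m},\qquad g^m=\partial_tv^m+v^m\cdot\nabla v^m-\nu_m\Delta v^m,\qquad g=\partial_tv+v\cdot\nabla v .$$ For $\alpha\in(0,1)$ let $\|f\|_{C^\alpha}=\sup|f|+\sup_{x\ne y}|f(x)-f(y)|/|x-y|^\alpha$ and $\|f\|_{C([0,1];C^\alpha(\mathbb T^2))}=\sup_{t\in[0,1]}\|f(\cdot,t)\|_{C^\alpha}$. **Lemma.** The fields $v^m$ and $v$ are smooth in $x$ at every $t\in[0,1]$ and differentiable in $t$ on $[0,1]$ (one-sidedly at the end points), so that $g^m$ and $g$ are defined classically. For every $\alpha\in(0,1)$, $g^m\in C([0,1];C^\alpha(\mathbb T^2))$ for every $m\ge2$, and there is a constant $C(\alpha)$, independent of $m$, such that $$\|g^m\|_{C([0,1];C^\alpha(\mathbb T^2))}\le C(\alpha)\qquad\text{for all }m\ge2 .$$ Moreover $g\in C([0,1];C^\alpha(\mathbb T^2))$ and $\|g^m-g\|_{C([0,1];C^\alpha(\mathbb T^2))}\to0$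 as $m\to\infty$. -/

import Mathlib

open Set Filter Topology MeasureTheory
open scoped NNReal ContDiff

noncomputable section

namespace QuasiSelfSimilar

/-- The plane with its Euclidean norm. Fields on the torus `𝕋² = ℝ² / ℤ²` are the `ℤ²`-periodic
fields on the plane. -/
abbrev Plane : Type := EuclideanSpace ℝ (Fin 2)

/-- `f` is `1`-periodic in each coordinate, i.e. a function on `𝕋²`. -/
def IsPeriodic {β : Type*} (f : Plane → β) : Prop :=
  ∀ (x : Plane) (i : Fin 2), f (x + EuclideanSpace.single i 1) = f x

/-- The closed unit square `[0,1]²`. -/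
def unitSquare : Set Plane := {x | ∀ i, x i ∈ Icc (0 : ℝ) 1}

/-- The open unit square `(0,1)²`. -/
def openUnitSquare : Set Plane := {x | ∀ i, x i ∈ Ioo (0 : ℝ) 1}

/-- The lower left corner `r(Q) = k / L` of the square `Q` with index `k` of the grid of
mesh `1 / L` of the unit square. -/
def corner (L : ℕ) (k : Fin 2 → Fin L) : Plane :=
  WithLp.toLp 2 fun i => ((k i : ℕ) : ℝ) / (L : ℝ)

/-- The open square `Q = r(Q) + (0, 1 / L)²` with index `k`; as `k` varies these are exactly the
squares of the grid of mesh `1 / L` in `[0,1]²`. -/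
def cell (L : ℕ) (k : Fin 2 → Fin L) : Set Plane :=
  {x | ∀ i, x i ∈ Ioo (corner L k i) (corner L k i + 1 / (L : ℝ))}

/-- The divergence of a planar vector field. -/
def divergence (u : Plane → Plane) (x : Plane) : ℝ :=
  ∑ i : Fin 2, fderiv ℝ u x (EuclideanSpace.single i 1) i

/-- The building blocks: smooth pairs `(V i, Θ i)` on `[0,1]² × [0,1]`, with `V i` divergence free
and tangent to the boundary of the square, `Θ i` of zero mean and unit `L²` norm, solving the
transport equation, and such that each `Θ i` at time `1` is, on each of the 25 squares of
side `1/5`, a rescaled copy of some `Θ j` at time `0`. -/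
structure IsBuildingBlocks {N : ℕ} (V : Fin N → Plane → ℝ → Plane)
    (Θ : Fin N → Plane → ℝ → ℝ) : Prop where
  one_lt : 1 < N
  smooth_V : ∀ i, ContDiffOn ℝ ∞ (fun p : Plane × ℝ => V i p.1 p.2)
    (unitSquare ×ˢ Icc (0 : ℝ) 1)
  div_V : ∀ i, ∀ t ∈ Icc (0 : ℝ) 1, ∀ x ∈ openUnitSquare,
    divergence (fun y => V i y t) x = 0
  tangent_V : ∀ i, ∀ t ∈ Icc (0 : ℝ) 1, ∀ x ∈ unitSquare, ∀ j : Fin 2,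
    (x j = 0 ∨ x j = 1) → V i x t j = 0
  smooth_Θ : ∀ i, ContDiffOn ℝ ∞ (fun p : Plane × ℝ => Θ i p.1 p.2)
    (unitSquare ×ˢ Icc (0 : ℝ) 1)
  nonconstant_Θ : ∀ i, ¬ ∃ c : ℝ, ∀ x ∈ unitSquare, ∀ t ∈ Icc (0 : ℝ) 1, Θ i x t = c
  mean_Θ : ∀ i, ∀ t ∈ Icc (0 : ℝ) 1, ∫ x in openUnitSquare, Θ i x t = 0
  sq_Θ : ∀ i, ∀ t ∈ Icc (0 : ℝ) 1, ∫ x in openUnitSquare, Θ i x t ^ 2 = 1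
  transport : ∀ i, ∀ t ∈ Icc (0 : ℝ) 1, ∀ x ∈ openUnitSquare,
    derivWithin (Θ i x) (Icc 0 1) t + fderiv ℝ (fun y => Θ i y t) x (V i x t) = 0
  selfSimilar : ∀ i, ∀ k : Fin 2 → Fin 5, ∃ j, ∀ x ∈ cell 5 k,
    Θ i x 1 = Θ j ((5 : ℝ) • (x - corner 5 k)) 0

/-- `ρ n` and `v n` are obtained on each square `Q` of the grid of mesh `1 / (2 · 5 ^ n)` by
rescaling the building block with number `idx n Q`. -/
def IsPatchedFrom {N : ℕ} (V : Fin N → Plane → ℝ → Plane) (Θ : Fin N → Plane → ℝ → ℝ)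
    (idx : (n : ℕ) → (Fin 2 → Fin (2 * 5 ^ n)) → Fin N)
    (ρ : ℕ → Plane → ℝ → ℝ) (v : ℕ → Plane → ℝ → Plane) : Prop :=
  ∀ (n : ℕ) (k : Fin 2 → Fin (2 * 5 ^ n)), ∀ x ∈ cell (2 * 5 ^ n) k, ∀ t ∈ Icc (0 : ℝ) 1,
    ρ n x t = Θ (idx n k) ((2 * 5 ^ n : ℝ) • (x - corner (2 * 5 ^ n) k)) t ∧
    v n x t = (1 / (2 * 5 ^ n) : ℝ) •
      V (idx n k) ((2 * 5 ^ n : ℝ) • (x - corner (2 * 5 ^ n) k)) t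

/-- A quasi-self-similar evolution `(ρ n, v n)`, extended `1`-periodically to the plane. No
quantitative estimate on `ρ n` and `v n` is part of the definition. -/
structure IsQuasiSelfSimilarFamily (ρ : ℕ → Plane → ℝ → ℝ) (v : ℕ → Plane → ℝ → Plane) :
    Prop where
  patched : ∃ (N : ℕ) (V : Fin N → Plane → ℝ → Plane) (Θ : Fin N → Plane → ℝ → ℝ)
    (idx : (n : ℕ) → (Fin 2 → Fin (2 * 5 ^ n)) → Fin N),
    IsBuildingBlocks V Θ ∧ IsPatchedFrom V Θ idx ρ v
  periodic_ρ : ∀ n, ∀ t ∈ Icc (0 : ℝ) 1, IsPeriodic fun x => ρ n x t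
  periodic_v : ∀ n, ∀ t ∈ Icc (0 : ℝ) 1, IsPeriodic fun x => v n x t
  smooth_ρ : ∀ n, ContDiffOn ℝ ∞ (fun p : Plane × ℝ => ρ n p.1 p.2)
    (univ ×ˢ Icc (0 : ℝ) 1)
  smooth_v : ∀ n, ContDiffOn ℝ ∞ (fun p : Plane × ℝ => v n p.1 p.2)
    (univ ×ˢ Icc (0 : ℝ) 1)
  /-- Inside the unit square, `ρ n` and `v n` are supported in a compact subset of its interior. -/
  support : ∀ n, ∃ K : Set Plane, IsCompact K ∧ K ⊆ openUnitSquare ∧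
    ∀ t ∈ Icc (0 : ℝ) 1, ∀ x ∈ unitSquare, x ∉ K → ρ n x t = 0 ∧ v n x t = 0
  div_v : ∀ n, ∀ t ∈ Icc (0 : ℝ) 1, ∀ x, divergence (fun y => v n y t) x = 0
  transport : ∀ n, ∀ t ∈ Icc (0 : ℝ) 1, ∀ x,
    derivWithin (ρ n x) (Icc 0 1) t + fderiv ℝ (fun y => ρ n y t) x (v n x t) = 0
  matching : ∀ n x, ρ n x 1 = ρ (n + 1) x 0

/-- The times `t_n = 1 - (n + 1) ^ (-2)`. -/
def tn (n : ℕ) : ℝ := 1 - 1 / ((n : ℝ) + 1) ^ 2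

/-- The time reparametrization: non-decreasing from `[0,1]` to `[0,1]`, smooth on `[0,1)`, fixing
every `t_n`, flat at every `t_n`, and with derivatives of order `k` bounded by a constant times
`(n + 1) ^ (5 k)` on `[t_n, t_{n+1})`. -/
structure IsTimeChange (η : ℝ → ℝ) : Prop where
  mapsTo : MapsTo η (Icc 0 1) (Icc 0 1)
  monotone : MonotoneOn η (Icc 0 1)
  smooth : ContDiffOn ℝ ∞ η (Ico 0 1)
  fixes : ∀ n, η (tn n) = tn n
  flat : ∀ n k : ℕ, 1 ≤ k → iteratedDerivWithin k η (Ico 0 1) (tn n) = 0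
  bound : ∀ k : ℕ, ∃ C : ℝ, ∀ n : ℕ, ∀ t ∈ Ico (tn n) (tn (n + 1)),
    |iteratedDerivWithin k η (Ico 0 1) t| ≤ C * ((n : ℝ) + 1) ^ (5 * k)

/-- The `n`-th term `χ_{[t_n,t_{n+1})}(s) (t_{n+1}-t_n)⁻¹ v_n(x, (s-t_n)/(t_{n+1}-t_n))`. -/
def stage (v : ℕ → Plane → ℝ → Plane) (n : ℕ) (x : Plane) (s : ℝ) : Plane :=
  (Ico (tn n) (tn (n + 1))).indicator
    (fun s => (1 / (tn (n + 1) - tn n)) • v n x ((s - tn n) / (tn (n + 1) - tn n))) s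

/-- The limit velocity field `v(x,t) = η'(t) ∑_{n ≥ 0} stage n (x, η(t))`. At most one term of the
sum is nonzero, and at `t = 1` all of them vanish. -/
def velocity (v : ℕ → Plane → ℝ → Plane) (η : ℝ → ℝ) (x : Plane) (t : ℝ) : Plane :=
  derivWithin η (Ico 0 1) t • ∑' n : ℕ, stage v n x (η t)

/-- The truncated velocity field `v^m(x,t) = η'(t) ∑_{n = 0}^m stage n (x, η(t))`. -/
def velocityTrunc (v : ℕ → Plane → ℝ → Plane) (η : ℝ → ℝ) (m : ℕ) (x : Plane) (t : ℝ) : Plane :=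
  derivWithin η (Ico 0 1) t • ∑ n ∈ Finset.range (m + 1), stage v n x (η t)

/-- The viscosity `ν_m = m ^ 10 · 5 ^ (-2 m)`. -/
def viscosity (m : ℕ) : ℝ := (m : ℝ) ^ 10 / 5 ^ (2 * m)

/-- The Euler force `∂_t u + u · ∇u` of a velocity field on `[0,1]` (one-sided time derivatives at
the end points). -/
def eulerForce (u : Plane → ℝ → Plane) (x : Plane) (t : ℝ) : Plane :=
  derivWithin (u x) (Icc 0 1) t + fderiv ℝ (fun y => u y t) x (u x t)

/-- The Navier-Stokes force `∂_t u + u · ∇u - ν Δu`. -/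
def nsForce (ν : ℝ) (u : Plane → ℝ → Plane) (x : Plane) (t : ℝ) : Plane :=
  eulerForce u x t - ν • Laplacian.laplacian (fun y => u y t) x

/-- `u(·,t)` is smooth on the plane and `u(x,·)` is differentiable on `[0,1]` (one-sided at the end
points), so that all the derivatives in the forces exist. -/
def HasClassicalDerivatives (u : Plane → ℝ → Plane) : Prop :=
  (∀ t ∈ Icc (0 : ℝ) 1, ContDiff ℝ ∞ fun x => u x t) ∧
  ∀ x, DifferentiableOn ℝ (u x) (Icc 0 1)

/-- The `C^α` norm: the supremum norm plus the Hölder seminorm, possibly infinite. -/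
def cHolderNorm (α : ℝ≥0) (f : Plane → Plane) : ENNReal :=
  (⨆ x, ‖f x‖ₑ) + eHolderNorm α f

/-- The norm of `C([0,1]; C^α)`, possibly infinite. -/
def cTimeHolderNorm (α : ℝ≥0) (f : Plane → ℝ → Plane) : ENNReal :=
  ⨆ t ∈ Icc (0 : ℝ) 1, cHolderNorm α fun x => f x t

/-- `f` belongs to `C([0,1]; C^α(𝕋²))`: each `f(·,t)` is a periodic function with finite `C^α`
norm, and `t ↦ f(·,t)` is continuous in the `C^α` norm. -/
structure MemCTimeHolder (α : ℝ≥0) (f : Plane → ℝ → Plane) : Prop where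
  periodic : ∀ t ∈ Icc (0 : ℝ) 1, IsPeriodic fun x => f x t
  finite : ∀ t ∈ Icc (0 : ℝ) 1, cHolderNorm α (fun x => f x t) < ⊤
  continuous : ∀ s ∈ Icc (0 : ℝ) 1,
    Tendsto (fun t => cHolderNorm α fun x => f x t - f x s) (𝓝[Icc 0 1] s) (𝓝 0)

end QuasiSelfSimilar

end

namespace QuasiSelfSimilar

/-! During the epoch `[t_n, t_{n+1}]` the velocity is a scalar rate `r_n = η' / (t_{n+1} - t_n)`
times `v_n` at a rescaled time. Since the transport term is quadratic, the force there equals `r_n'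
v_n + r_n² (∂_t v_n + v_n·∇v_n) - ν r_n Δv_n`, and flatness of `η` at the `t_n` makes these formulas
agree at common end points (`velocity_eq`, `nsForce_velocity_eq`).

Each `v_n` is patched from finitely many smooth blocks with amplitude and length scale comparable to
`5^{-n}`. Hence `v_n` and its Euler force have size `5^{-n}`, its Laplacian has size `5^n`, and one
more derivative in space costs `5^n`, with a constant independent of `n`
(`exists_isControlledFamily`). Interpolation between sup and Lipschitz bounds shows that a `C^α`
norm costs only `5^{αn}` (`cHolderNorm_le`). The coefficients in time are polynomial in `n`
(`exists_bounds`).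

The inertial part in epoch `n` is therefore at most a multiple of `(n+1)^16 5^{-(1-α)n}`. For `n ≤
m`, the viscous part with `ν_m = m^10 5^{-2m}` is largest at `n = m`, where it is at most a multiple
of `(m+1)^26 5^{-(1-α)m}` (`inertial_le`, `viscous_le`). This gives the uniform bound and continuity
at `t = 1`. The difference of the forces is the viscous part for `n ≤ m` and minus the limit force
for `n > m`, so it tends to zero uniformly in time. -/

variable {E F : Type*} [NormedAddCommGroup E] [NormedSpace ℝ E]
  [NormedAddCommGroup F] [NormedSpace ℝ F]

/-! ### Calculus of fields that are smooth up to the boundary -/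

/-- The time derivative on `[0,1]`, one-sided at the end points. -/
noncomputable def timeDeriv (f : Plane → ℝ → E) (x : Plane) (t : ℝ) : E :=
  derivWithin (f x) (Icc 0 1) t

/-- The Fréchet derivative in space. -/
noncomputable def spaceDeriv (f : Plane → ℝ → E) (x : Plane) (t : ℝ) : Plane →L[ℝ] E :=
  fderiv ℝ (fun y => f y t) x

/-- On the interior of `U`, and for times in `[0,1]`, `f` coincides with a function that is smooth
on `U × [0,1]`. -/
def SmoothUpTo (U : Set Plane) (f : Plane → ℝ → E) : Prop :=
  ∃ W : Plane × ℝ → E, ContDiffOn ℝ ∞ W (U ×ˢ Icc (0 : ℝ) 1) ∧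
    ∀ x ∈ interior U, ∀ t ∈ Icc (0 : ℝ) 1, f x t = W (x, t)

/-- The trace of a bilinear map on the plane. -/
noncomputable def planeTrace : (Plane →L[ℝ] Plane →L[ℝ] E) →L[ℝ] E :=
  ∑ i : Fin 2, (ContinuousLinearMap.apply ℝ E (EuclideanSpace.single i (1 : ℝ))).comp
    (ContinuousLinearMap.apply ℝ (Plane →L[ℝ] E) (EuclideanSpace.single i (1 : ℝ)))

theorem laplacian_eq_planeTrace (f : Plane → ℝ → E) (x : Plane) (t : ℝ) :
    Laplacian.laplacian (fun y => f y t) x = planeTrace (spaceDeriv (spaceDeriv f) x t) := by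
  rw [InnerProductSpace.laplacian_eq_iteratedFDeriv_orthonormalBasis _
    (EuclideanSpace.basisFun (Fin 2) ℝ)]
  simp [planeTrace, iteratedFDeriv_two_apply, spaceDeriv]

theorem eulerForce_eq (f : Plane → ℝ → Plane) (x : Plane) (t : ℝ) :
    eulerForce f x t = timeDeriv f x t + spaceDeriv f x t (f x t) := rfl

namespace SmoothUpTo

variable {U : Set Plane} {f : Plane → ℝ → E}

theorem of_contDiffOn (h : ContDiffOn ℝ ∞ (fun p : Plane × ℝ => f p.1 p.2)
    (U ×ˢ Icc (0 : ℝ) 1)) : SmoothUpTo U f :=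
  ⟨_, h, fun _ _ _ _ => rfl⟩

theorem contDiffOn (h : SmoothUpTo univ f) :
    ContDiffOn ℝ ∞ (fun p : Plane × ℝ => f p.1 p.2) (univ ×ˢ Icc (0 : ℝ) 1) := by
  obtain ⟨W, hW, hfW⟩ := h
  exact hW.congr fun p hp => hfW p.1 (by simp) p.2 hp.2

theorem uniqueDiffOn_prod (hU : Convex ℝ U) (hne : (interior U).Nonempty) :
    UniqueDiffOn ℝ (U ×ˢ Icc (0 : ℝ) 1) :=
  (uniqueDiffOn_convex hU hne).prod (uniqueDiffOn_Icc zero_lt_one)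

/-- Differentiating the extension `W` within the product, rather than `f`, keeps the derivative
smooth up to the boundary. The class is thus closed under all operations that build the forces, and
compactness then bounds every derived field. -/
theorem timeDeriv (hU : Convex ℝ U) (hne : (interior U).Nonempty) (h : SmoothUpTo U f) :
    SmoothUpTo U (timeDeriv f) := by
  obtain ⟨W, hW, hfW⟩ := h
  have hS := uniqueDiffOn_prod hU hne
  refine ⟨fun p => fderivWithin ℝ W (U ×ˢ Icc (0 : ℝ) 1) p (0, 1),
    (hW.fderivWithin hS (m := ∞) le_rfl).clm_apply contDiffOn_const, fun x hx t ht => ?_⟩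
  have hxU := interior_subset hx
  have h1 := (hW.differentiableOn (by simp) (x, t) ⟨hxU, ht⟩).hasFDerivWithinAt
  have h2 : HasDerivWithinAt (fun s : ℝ => (x, s)) ((0 : Plane), (1 : ℝ)) (Icc 0 1) t :=
    (hasDerivWithinAt_const t _ x).prodMk (hasDerivWithinAt_id t _)
  have h3 := h1.comp_hasDerivWithinAt t h2 (fun s hs => ⟨hxU, hs⟩)
  refine HasDerivWithinAt.derivWithin ?_ (uniqueDiffOn_Icc zero_lt_one t ht)
  exact h3.congr (fun s hs => hfW x hx s hs) (hfW x hx t ht)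

/-- The derivative of `W` within the product may be one-sided in time, but at an interior point of
`U` its restriction to spatial directions is a genuine two-sided derivative. -/
theorem hasFDerivAt {W : Plane × ℝ → E}
    (hW : ContDiffOn ℝ ∞ W (U ×ˢ Icc (0 : ℝ) 1))
    (hfW : ∀ x ∈ interior U, ∀ t ∈ Icc (0 : ℝ) 1, f x t = W (x, t))
    {x : Plane} (hx : x ∈ interior U) {t : ℝ} (ht : t ∈ Icc (0 : ℝ) 1) :
    HasFDerivAt (fun y => f y t) ((fderivWithin ℝ W (U ×ˢ Icc (0 : ℝ) 1) (x, t)).comp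
      (ContinuousLinearMap.inl ℝ Plane ℝ)) x := by
  have hxU := interior_subset hx
  have h1 := (hW.differentiableOn (by simp) (x, t) ⟨hxU, ht⟩).hasFDerivWithinAt
  have h2 : HasFDerivWithinAt (fun y : Plane => (y, t)) (ContinuousLinearMap.inl ℝ Plane ℝ)
      (interior U) x := (hasFDerivAt_prodMk_left x t).hasFDerivWithinAt
  have h4 : MapsTo (fun y : Plane => (y, t)) (interior U) (U ×ˢ Icc (0 : ℝ) 1) :=
    fun y hy => ⟨interior_subset hy, ht⟩
  have h3 := h1.comp x h2 h4
  exact (h3.congr (fun y hy => hfW y hy t ht) (hfW x hx t ht)).hasFDerivAt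
    (isOpen_interior.mem_nhds hx)

theorem spaceDeriv (hU : Convex ℝ U) (hne : (interior U).Nonempty) (h : SmoothUpTo U f) :
    SmoothUpTo U (spaceDeriv f) := by
  obtain ⟨W, hW, hfW⟩ := h
  refine ⟨fun p => (fderivWithin ℝ W (U ×ˢ Icc (0 : ℝ) 1) p).comp
    (ContinuousLinearMap.inl ℝ Plane ℝ),
    (hW.fderivWithin (uniqueDiffOn_prod hU hne) (m := ∞) le_rfl).clm_comp contDiffOn_const,
    fun x hx t ht => (hasFDerivAt hW hfW hx ht).fderiv⟩

theorem add {g : Plane → ℝ → E} (hf : SmoothUpTo U f) (hg : SmoothUpTo U g) :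
    SmoothUpTo U (fun x t => f x t + g x t) := by
  obtain ⟨W, hW, hfW⟩ := hf
  obtain ⟨Z, hZ, hgZ⟩ := hg
  exact ⟨fun p => W p + Z p, hW.add hZ, fun x hx t ht => by
      beta_reduce; rw [hfW x hx t ht, hgZ x hx t ht]⟩

theorem clm_apply {A : Plane → ℝ → E →L[ℝ] F} (hA : SmoothUpTo U A) (hf : SmoothUpTo U f) :
    SmoothUpTo U (fun x t => A x t (f x t)) := by
  obtain ⟨W, hW, hfW⟩ := hf
  obtain ⟨Z, hZ, hgZ⟩ := hA
  exact ⟨fun p => Z p (W p), hZ.clm_apply hW,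
    fun x hx t ht => by
      beta_reduce; rw [hfW x hx t ht, hgZ x hx t ht]⟩

theorem clm_comp (T : E →L[ℝ] F) (hf : SmoothUpTo U f) :
    SmoothUpTo U (fun x t => T (f x t)) := by
  obtain ⟨W, hW, hfW⟩ := hf
  exact ⟨fun p => T (W p), T.contDiff.comp_contDiffOn hW,
    fun x hx t ht => by beta_reduce; rw [hfW x hx t ht]⟩

theorem eulerForce {f : Plane → ℝ → Plane} (hU : Convex ℝ U) (hne : (interior U).Nonempty)
    (h : SmoothUpTo U f) : SmoothUpTo U (eulerForce f) :=
  (h.timeDeriv hU hne).add ((h.spaceDeriv hU hne).clm_apply h)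

theorem laplacian (hU : Convex ℝ U) (hne : (interior U).Nonempty)
    (h : SmoothUpTo U f) :
    SmoothUpTo U (fun x t => Laplacian.laplacian (fun y => f y t) x) := by
  simp only [laplacian_eq_planeTrace]
  exact ((h.spaceDeriv hU hne).spaceDeriv hU hne).clm_comp planeTrace

theorem exists_bound (hU : IsCompact U) (h : SmoothUpTo U f) :
    ∃ M : ℝ, ∀ x ∈ interior U, ∀ t ∈ Icc (0 : ℝ) 1, ‖f x t‖ ≤ M := by
  obtain ⟨W, hW, hfW⟩ := h
  obtain ⟨M, hM⟩ := (hU.prod isCompact_Icc).exists_bound_of_continuousOn hW.continuousOn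
  exact ⟨M, fun x hx t ht => by
    rw [hfW x hx t ht]; exact hM (x, t) ⟨interior_subset hx, ht⟩⟩

theorem contDiff_space (h : SmoothUpTo univ f) {t : ℝ} (ht : t ∈ Icc (0 : ℝ) 1) :
    ContDiff ℝ ∞ fun x => f x t := by
  rw [← contDiffOn_univ]
  exact h.contDiffOn.comp (f := fun x : Plane => (x, t)) (by fun_prop)
    (fun x _ => ⟨mem_univ _, ht⟩)

theorem differentiableOn_time (h : SmoothUpTo univ f) (x : Plane) :
    DifferentiableOn ℝ (f x) (Icc 0 1) :=
  (h.contDiffOn.comp (f := fun t : ℝ => (x, t)) (by fun_prop)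
    (fun t ht => ⟨mem_univ _, ht⟩)).differentiableOn (by simp)

end SmoothUpTo

/-! ### Geometry of the unit square -/

theorem convex_unitSquare : Convex ℝ unitSquare := by
  intro x hx y hy a b ha hb hab i
  have := convex_Icc (0 : ℝ) 1 (hx i) (hy i) ha hb hab
  simpa using this

theorem isCompact_unitSquare : IsCompact unitSquare := by
  have h : unitSquare = (WithLp.toLp 2) '' (univ.pi fun _ : Fin 2 => Icc (0 : ℝ) 1) := by
    ext x
    constructor
    · intro hx
      exact ⟨x.ofLp, fun i _ => hx i, rfl⟩
    · rintro ⟨y, hy, rfl⟩ i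
      exact hy i (mem_univ i)
  rw [h]
  exact (isCompact_univ_pi fun _ => isCompact_Icc).image (PiLp.continuous_toLp 2 _)

theorem isOpen_openUnitSquare : IsOpen openUnitSquare := by
  have h : openUnitSquare = ⋂ i : Fin 2, (fun x : Plane => x i) ⁻¹' Ioo (0 : ℝ) 1 := by
    ext x; simp [openUnitSquare]
  rw [h]
  exact isOpen_iInter_of_finite fun i => isOpen_Ioo.preimage (by fun_prop)

theorem openUnitSquare_subset_interior : openUnitSquare ⊆ interior unitSquare :=
  isOpen_openUnitSquare.subset_interior_iff.2 fun _ hx i => Ioo_subset_Icc_self (hx i)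

theorem interior_unitSquare_nonempty : (interior unitSquare).Nonempty :=
  ⟨WithLp.toLp 2 fun _ => 1 / 2,
    openUnitSquare_subset_interior fun _ => ⟨by norm_num, by norm_num⟩⟩

/-! ### Rescaled copies on a grid, and bounds uniform in the mesh -/

section Patching

variable {E F : Type*} [NormedAddCommGroup E] [NormedSpace ℝ E]
  [NormedAddCommGroup F] [NormedSpace ℝ F] {ι : Type*}

/-- On each cell of the grid of mesh `1 / L`, `f` is a rescaled copy, with amplitude `c`, of one of
the fields `G i`. -/
def Patched (L : ℕ) (idx : (Fin 2 → Fin L) → ι) (c : ℝ) (f : Plane → ℝ → E)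
    (G : ι → Plane → ℝ → E) : Prop :=
  ∀ k, ∀ x ∈ cell L k, ∀ t ∈ Icc (0 : ℝ) 1,
    f x t = c • G (idx k) ((L : ℝ) • (x - corner L k)) t

theorem isOpen_cell (L : ℕ) (k : Fin 2 → Fin L) : IsOpen (cell L k) := by
  have h : cell L k = ⋂ i : Fin 2, (fun x : Plane => x i) ⁻¹'
      Ioo (corner L k i) (corner L k i + 1 / (L : ℝ)) := by
    ext x; simp [cell]
  rw [h]
  exact isOpen_iInter_of_finite fun i => isOpen_Ioo.preimage (by fun_prop)

theorem smul_sub_corner_mem {L : ℕ} (hL : 0 < L) {k : Fin 2 → Fin L} {x : Plane}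
    (hx : x ∈ cell L k) : (L : ℝ) • (x - corner L k) ∈ openUnitSquare := by
  intro i
  have hL' : (0 : ℝ) < L := by exact_mod_cast hL
  obtain ⟨h1, h2⟩ := hx i
  have h3 : (L : ℝ) * (1 / L) = 1 := by field_simp
  simp only [PiLp.smul_apply, PiLp.sub_apply, smul_eq_mul, mem_Ioo]
  constructor
  · exact mul_pos hL' (by linarith)
  · calc (L : ℝ) * (x i - corner L k i) < L * (1 / L) :=
          mul_lt_mul_of_pos_left (by linarith) hL'
      _ = 1 := h3

theorem IsPeriodic.add_intCast {β : Type*} {f : Plane → β} (hf : IsPeriodic f) (x : Plane)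
    (m : Fin 2 → ℤ) : f (x + WithLp.toLp 2 fun i => (m i : ℝ)) = f x := by
  have h : ∀ i, Function.Periodic f (EuclideanSpace.single i (1 : ℝ)) := fun i x => hf x i
  have h2 := (((h 0).zsmul (m 0)).add_period ((h 1).zsmul (m 1))) x
  rw [← h2]
  congr 2
  ext i
  fin_cases i <;> simp

theorem IsPeriodic.exists_fract {β : Type*} {f : Plane → β} (hf : IsPeriodic f) (x : Plane) :
    ∃ y : Plane, (∀ i, y i ∈ Ico (0 : ℝ) 1) ∧ f y = f x := by
  refine ⟨WithLp.toLp 2 fun i => Int.fract (x i),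
    fun i => ⟨Int.fract_nonneg _, Int.fract_lt_one _⟩, ?_⟩
  rw [← hf.add_intCast _ fun i => ⌊x i⌋]
  congr 1
  ext i
  simp [Int.fract_add_floor]

theorem exists_mem_closure_cell {L : ℕ} (hL : 0 < L) {x : Plane}
    (hx : ∀ i, x i ∈ Ico (0 : ℝ) 1) : ∃ k : Fin 2 → Fin L, x ∈ closure (cell L k) := by
  have hL' : (0 : ℝ) < L := by exact_mod_cast hL
  have hk : ∀ i, ⌊(L : ℝ) * x i⌋₊ < L := fun i => by
    rw [Nat.floor_lt (mul_nonneg hL'.le (hx i).1)]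
    calc (L : ℝ) * x i < L * 1 := mul_lt_mul_of_pos_left (hx i).2 hL'
      _ = L := mul_one _
  set k : Fin 2 → Fin L := fun i => ⟨⌊(L : ℝ) * x i⌋₊, hk i⟩ with hkdef
  have hc : ∀ i, corner L k i ≤ x i ∧ x i < corner L k i + 1 / L := fun i => by
    have h1 := Nat.floor_le (mul_nonneg hL'.le (hx i).1)
    have h2 := Nat.lt_floor_add_one ((L : ℝ) * x i)
    simp only [corner, hkdef]
    rw [← add_div, div_le_iff₀ hL', lt_div_iff₀ hL', mul_comm (x i)]
    exact ⟨h1, h2⟩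
  -- The point may lie on the left or lower edge of its cell; moving it by `(δ, δ)` with small `δ >
  -- 0` puts it into the open cell.
  refine ⟨k, mem_closure_of_tendsto (b := 𝓝[>] (0 : ℝ))
    (f := fun δ : ℝ => x + WithLp.toLp 2 fun _ => δ) ?_ ?_⟩
  · have h : Continuous fun δ : ℝ => x + (WithLp.toLp 2 fun _ => δ : Plane) :=
      continuous_const.add ((PiLp.continuous_toLp 2 _).comp (continuous_pi fun _ => continuous_id))
    have h0 : x + (WithLp.toLp 2 fun _ => (0 : ℝ) : Plane) = x := by
      ext i; simp
    simpa [h0] using (h.tendsto 0).mono_left nhdsWithin_le_nhds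
  · have h : ∀ i, ∀ᶠ δ : ℝ in 𝓝[>] (0 : ℝ), x i + δ < corner L k i + 1 / L := fun i => by
      refine Filter.Eventually.filter_mono nhdsWithin_le_nhds ?_
      refine (continuous_const.add continuous_id).tendsto' (0 : ℝ) (x i) (by simp)
        |>.eventually_lt_const (hc i).2
    filter_upwards [self_mem_nhdsWithin, eventually_all.2 h] with δ hδ h i
    exact ⟨lt_of_le_of_lt (hc i).1 (by simpa using hδ), by simpa using h i⟩

namespace Patched

variable {L : ℕ} {idx : (Fin 2 → Fin L) → ι} {c d : ℝ} {f g : Plane → ℝ → E}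
  {G H : ι → Plane → ℝ → E}

theorem timeDeriv (h : Patched L idx c f G) :
    Patched L idx c (timeDeriv f) fun i => timeDeriv (G i) := by
  intro k x hx t ht
  unfold QuasiSelfSimilar.timeDeriv
  rw [derivWithin_congr (fun s hs => h k x hx s hs) (h k x hx t ht)]
  exact derivWithin_fun_const_smul_field c _

theorem spaceDeriv (h : Patched L idx c f G) :
    Patched L idx (c * L) (spaceDeriv f) fun i => spaceDeriv (G i) := by
  intro k x hx t ht
  have h1 : (fun y => f y t) =ᶠ[𝓝 x]
      c • fun y => G (idx k) ((L : ℝ) • (y - corner L k)) t := by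
    filter_upwards [(isOpen_cell L k).mem_nhds hx] with y hy using h k y hy t ht
  unfold QuasiSelfSimilar.spaceDeriv
  rw [h1.fderiv_eq, fderiv_const_smul_field, Pi.smul_apply,
    fderiv_comp_sub (f := fun y => G (idx k) ((L : ℝ) • y) t) (corner L k),
    fderiv_comp_smul (f := fun y => G (idx k) y t) (L : ℝ), mul_smul]

theorem add (hf : Patched L idx c f G) (hg : Patched L idx c g H) :
    Patched L idx c (fun x t => f x t + g x t) fun i x t => G i x t + H i x t := by
  intro k x hx t ht
  beta_reduce
  rw [hf k x hx t ht, hg k x hx t ht, smul_add]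

theorem clm_apply {A : Plane → ℝ → E →L[ℝ] F} {B : ι → Plane → ℝ → E →L[ℝ] F}
    (hA : Patched L idx d A B) (hf : Patched L idx c f G) :
    Patched L idx (d * c) (fun x t => A x t (f x t)) fun i x t => B i x t (G i x t) := by
  intro k x hx t ht
  beta_reduce
  rw [hA k x hx t ht, hf k x hx t ht, map_smul, _root_.smul_apply, smul_smul,
    mul_comm]

theorem clm_comp (T : E →L[ℝ] F) (hf : Patched L idx c f G) :
    Patched L idx c (fun x t => T (f x t)) fun i x t => T (G i x t) := by
  intro k x hx t ht
  beta_reduce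
  rw [hf k x hx t ht, map_smul]

/-- Amplitude `1 / L` at scale `1 / L` is the balance at which both terms scale alike: the gradient
has amplitude `1`, so the transport term keeps amplitude `1 / L`. -/
theorem eulerForce {f : Plane → ℝ → Plane} {G : ι → Plane → ℝ → Plane} (hL : 0 < L)
    (h : Patched L idx (1 / L) f G) :
    Patched L idx (1 / L) (eulerForce f) fun i => eulerForce (G i) := by
  have h1 := h.spaceDeriv.clm_apply h
  have hL' : (L : ℝ) ≠ 0 := by exact_mod_cast hL.ne'
  have h2 : (1 / (L : ℝ)) * L * (1 / L) = 1 / L := by field_simp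
  rw [h2] at h1
  exact h.timeDeriv.add h1

theorem laplacian (hL : 0 < L) (h : Patched L idx (1 / L) f G) :
    Patched L idx L (fun x t => Laplacian.laplacian (fun y => f y t) x)
      fun i x t => Laplacian.laplacian (fun y => G i y t) x := by
  simp only [laplacian_eq_planeTrace]
  have h1 := h.spaceDeriv.spaceDeriv.clm_comp planeTrace
  have hL' : (L : ℝ) ≠ 0 := by exact_mod_cast hL.ne'
  have h2 : (1 / (L : ℝ)) * L * L = L := by field_simp
  rwa [h2] at h1

/-- The patching identity says nothing on cell edges. Periodicity brings the point into the unit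
square, the closed cells cover it, and continuity carries the bound to the closures. -/
theorem norm_le {M : ℝ} (hL : 0 < L) (h : Patched L idx c f G)
    (hf : ∀ t ∈ Icc (0 : ℝ) 1, Continuous fun x => f x t)
    (hp : ∀ t ∈ Icc (0 : ℝ) 1, IsPeriodic fun x => f x t)
    (hG : ∀ i, ∀ x ∈ openUnitSquare, ∀ t ∈ Icc (0 : ℝ) 1, ‖G i x t‖ ≤ M) :
    ∀ t ∈ Icc (0 : ℝ) 1, ∀ x, ‖f x t‖ ≤ |c| * M := by
  intro t ht x
  obtain ⟨y, hy, hxy⟩ := (hp t ht).exists_fract x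
  obtain ⟨k, hk⟩ := exists_mem_closure_cell hL hy
  rw [← hxy]
  have hclosed : IsClosed {z : Plane | ‖f z t‖ ≤ |c| * M} :=
    isClosed_le (hf t ht).norm continuous_const
  refine closure_minimal (fun z hz => ?_) hclosed hk
  rw [mem_ofPred_eq, h k z hz t ht, norm_smul, Real.norm_eq_abs]
  exact mul_le_mul_of_nonneg_left (hG _ _ (smul_sub_corner_mem hL hz) t ht) (abs_nonneg c)

end Patched

theorem IsPeriodic.timeDeriv {f : Plane → ℝ → E}
    (hp : ∀ t ∈ Icc (0 : ℝ) 1, IsPeriodic fun x => f x t) :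
    ∀ t ∈ Icc (0 : ℝ) 1, IsPeriodic fun x => timeDeriv f x t := fun t ht x i =>
  derivWithin_congr (fun s hs => hp s hs x i) (hp t ht x i)

theorem IsPeriodic.spaceDeriv {f : Plane → ℝ → E}
    {t : ℝ} (hp : IsPeriodic fun x => f x t) : IsPeriodic fun x => spaceDeriv f x t := by
  intro x i
  unfold QuasiSelfSimilar.spaceDeriv
  beta_reduce
  rw [← fderiv_comp_add_right (f := fun y => f y t)]
  congr 1
  funext y
  exact hp y i

theorem IsPeriodic.eulerForce {f : Plane → ℝ → Plane}
    (hp : ∀ t ∈ Icc (0 : ℝ) 1, IsPeriodic fun x => f x t) :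
    ∀ t ∈ Icc (0 : ℝ) 1, IsPeriodic fun x => eulerForce f x t := fun t ht x i => by
  have h1 := IsPeriodic.timeDeriv hp t ht x i
  have h2 := (hp t ht).spaceDeriv x i
  have h3 := hp t ht x i
  simp only [eulerForce_eq] at *
  rw [h1, h2, h3]

theorem IsPeriodic.laplacian {f : Plane → ℝ → E} {t : ℝ} (hp : IsPeriodic fun x => f x t) :
    IsPeriodic fun x => Laplacian.laplacian (fun y => f y t) x := fun x i => by
  have h1 := hp.spaceDeriv.spaceDeriv x i
  simp only [laplacian_eq_planeTrace] at *
  rw [h1]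

/-- A periodic field on `[0,1]` bounded by `A`, which is `A R`-Lipschitz in space and `A`-Lipschitz
in time. -/
structure Controlled (A R : ℝ) (f : Plane → ℝ → E) : Prop where
  periodic : ∀ t ∈ Icc (0 : ℝ) 1, IsPeriodic fun x => f x t
  norm_le : ∀ t ∈ Icc (0 : ℝ) 1, ∀ x, ‖f x t‖ ≤ A
  space : ∀ t ∈ Icc (0 : ℝ) 1, ∀ x y, ‖f x t - f y t‖ ≤ A * R * ‖x - y‖
  time : ∀ s ∈ Icc (0 : ℝ) 1, ∀ t ∈ Icc (0 : ℝ) 1, ∀ x, ‖f x t - f x s‖ ≤ A * |t - s|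

theorem Controlled.mono {E : Type*} [NormedAddCommGroup E] {A A' R : ℝ}
    {f : Plane → ℝ → E} (h : Controlled A R f) (hA : A ≤ A') (hR : 0 ≤ R) : Controlled A' R f where
  periodic := h.periodic
  norm_le t ht x := (h.norm_le t ht x).trans hA
  space t ht x y := (h.space t ht x y).trans (by gcongr)
  time s hs t ht x := (h.time s hs t ht x).trans (by gcongr)

theorem controlled_zero {E : Type*} [NormedAddCommGroup E] {R : ℝ} :
    Controlled 0 R (fun _ _ => 0 : Plane → ℝ → E) where
  periodic _ _ _ _ := rfl
  norm_le _ _ _ := by simp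
  space _ _ _ _ := by simp
  time _ _ _ _ _ := by simp

/-- Mean value inequality in space and in time. The factor `2` absorbs `L ≤ 2 R`, which will be used
with `L = 2 · 5 ^ n` and `R = 5 ^ n`. -/
theorem Patched.controlled {L : ℕ} {idx : (Fin 2 → Fin L) → ι} {c M R : ℝ}
    {f : Plane → ℝ → E} {G : ι → Plane → ℝ → E} (hL : 0 < L) (hR : (L : ℝ) ≤ 2 * R)
    (h : Patched L idx c f G) (hf : SmoothUpTo univ f)
    (hp : ∀ t ∈ Icc (0 : ℝ) 1, IsPeriodic fun x => f x t) (hM : 0 ≤ M)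
    (hG : ∀ i, ∀ x ∈ openUnitSquare, ∀ t ∈ Icc (0 : ℝ) 1, ‖G i x t‖ ≤ M)
    (hGt : ∀ i, ∀ x ∈ openUnitSquare, ∀ t ∈ Icc (0 : ℝ) 1, 
      ‖QuasiSelfSimilar.timeDeriv (G i) x t‖ ≤ M)
    (hGx : ∀ i, ∀ x ∈ openUnitSquare, ∀ t ∈ Icc (0 : ℝ) 1, 
      ‖QuasiSelfSimilar.spaceDeriv (G i) x t‖ ≤ M) :
    Controlled (2 * |c| * M) R f := by
  have huniv : (interior (univ : Set Plane)).Nonempty := by simp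
  have hft := hf.timeDeriv convex_univ huniv
  have hfx := hf.spaceDeriv convex_univ huniv
  have hc : 0 ≤ |c| * M := by positivity
  have hL0 : (0 : ℝ) ≤ L := by positivity
  refine ⟨hp, fun t ht x => ?_, fun t ht x y => ?_, fun s hs t ht x => ?_⟩
  · have := h.norm_le hL (fun t ht => (hf.contDiff_space ht).continuous) hp hG t ht x
    linarith
  · have hb := h.spaceDeriv.norm_le hL (fun t ht => (hfx.contDiff_space ht).continuous)
      (fun t ht => (hp t ht).spaceDeriv) hGx t ht
    have := convex_univ.norm_image_sub_le_of_norm_fderiv_le (𝕜 := ℝ)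
      (fun z _ => ((hf.contDiff_space ht).differentiable (by simp)) z) (fun z _ => hb z)
      (mem_univ y) (mem_univ x)
    refine this.trans (mul_le_mul_of_nonneg_right ?_ (norm_nonneg _))
    rw [abs_mul, abs_of_nonneg hL0]
    nlinarith
  · have hb := h.timeDeriv.norm_le hL (fun t ht => (hft.contDiff_space ht).continuous)
      (IsPeriodic.timeDeriv hp) hGt
    have := (convex_Icc (0 : ℝ) 1).norm_image_sub_le_of_norm_derivWithin_le
      (hf.differentiableOn_time x) (fun r hr => hb r hr x) hs ht
    refine this.trans (mul_le_mul_of_nonneg_right ?_ (norm_nonneg _))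
    linarith

theorem exists_uniform_bound {N : ℕ} {G : Fin N → Plane → ℝ → E}
    (hG : ∀ i, SmoothUpTo unitSquare (G i)) :
    ∃ M : ℝ, 0 ≤ M ∧ ∀ i, ∀ x ∈ openUnitSquare, ∀ t ∈ Icc (0 : ℝ) 1, ‖G i x t‖ ≤ M := by
  choose M hM using fun i => (hG i).exists_bound isCompact_unitSquare
  refine ⟨∑ i, |M i|, by positivity, fun i x hx t ht => ?_⟩
  calc ‖G i x t‖ ≤ M i := hM i x (openUnitSquare_subset_interior hx) t ht
    _ ≤ |M i| := le_abs_self _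
    _ ≤ ∑ i, |M i| := Finset.single_le_sum (f := fun i => |M i|) (fun j _ => abs_nonneg _)
        (Finset.mem_univ i)

/-- `M` is chosen before the mesh, the index map and the patched field: it depends only on the
finitely many blocks. This is what makes the estimates uniform in `n`. -/
theorem exists_controlled {N : ℕ} {G : Fin N → Plane → ℝ → E}
    (hG : ∀ i, SmoothUpTo unitSquare (G i)) :
    ∃ M : ℝ, 0 ≤ M ∧ ∀ (L : ℕ) (idx : (Fin 2 → Fin L) → Fin N) (c R : ℝ) (f : Plane → ℝ → E),
      0 < L → (L : ℝ) ≤ 2 * R → Patched L idx c f G → SmoothUpTo univ f →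
      (∀ t ∈ Icc (0 : ℝ) 1, IsPeriodic fun x => f x t) → Controlled (2 * |c| * M) R f := by
  obtain ⟨M₁, h₁, hM₁⟩ := exists_uniform_bound hG
  obtain ⟨M₂, h₂, hM₂⟩ := exists_uniform_bound fun i =>
    (hG i).timeDeriv convex_unitSquare interior_unitSquare_nonempty
  obtain ⟨M₃, h₃, hM₃⟩ := exists_uniform_bound fun i =>
    (hG i).spaceDeriv convex_unitSquare interior_unitSquare_nonempty
  refine ⟨M₁ + M₂ + M₃, by positivity, fun L idx c R f hL hR h hf hp =>
    h.controlled hL hR hf hp (by positivity) (fun i x hx t ht => ?_) (fun i x hx t ht => ?_)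
      fun i x hx t ht => ?_⟩
  · linarith [hM₁ i x hx t ht]
  · linarith [hM₂ i x hx t ht]
  · linarith [hM₃ i x hx t ht]

end Patching

/-! ### Uniform scale estimates for the family `v n` -/

/-- A sequence of smooth fields whose Euler forces and Laplacians are controlled at the
spatial scale `5 ^ (-n)`. -/
structure IsControlledFamily (M : ℝ) (D : ℕ → ℝ) (w : ℕ → Plane → ℝ → Plane) : Prop where
  smooth : ∀ n, SmoothUpTo univ (w n)
  self : ∀ n, Controlled (M / 5 ^ n) (5 ^ n) (w n)
  euler : ∀ n, Controlled (M / 5 ^ n) (5 ^ n) (eulerForce (w n))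
  laplacian : ∀ n, Controlled (D n) (5 ^ n) fun x t => Laplacian.laplacian (fun y => w n y t) x

theorem IsQuasiSelfSimilarFamily.exists_isControlledFamily {ρ : ℕ → Plane → ℝ → ℝ}
    {v : ℕ → Plane → ℝ → Plane} (hv : IsQuasiSelfSimilarFamily ρ v) :
    ∃ M : ℝ, 0 ≤ M ∧ IsControlledFamily M (fun n => M * 5 ^ n) v := by
  obtain ⟨N, V, Θ, idx, hB, hP⟩ := hv.patched
  have huniv : (interior (univ : Set Plane)).Nonempty := by simp
  have hV : ∀ i, SmoothUpTo unitSquare (V i) := fun i => .of_contDiffOn (hB.smooth_V i)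
  have hs : ∀ n, SmoothUpTo univ (v n) := fun n => .of_contDiffOn (hv.smooth_v n)
  have hpat : ∀ n, Patched (2 * 5 ^ n) (idx n) (1 / (2 * 5 ^ n : ℕ)) (v n) V := by
    intro n k x hx t ht
    rw [(hP n k x hx t ht).2]
    push_cast
    rfl
  have hL : ∀ n : ℕ, 0 < 2 * 5 ^ n := fun n => by positivity
  have hR : ∀ n : ℕ, ((2 * 5 ^ n : ℕ) : ℝ) ≤ 2 * 5 ^ n := fun n => by push_cast; exact le_rfl
  obtain ⟨M₁, h₁, hM₁⟩ := exists_controlled hV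
  obtain ⟨M₂, h₂, hM₂⟩ := exists_controlled fun i =>
    (hV i).eulerForce convex_unitSquare interior_unitSquare_nonempty
  obtain ⟨M₃, h₃, hM₃⟩ := exists_controlled fun i =>
    (hV i).laplacian convex_unitSquare interior_unitSquare_nonempty
  have hc : ∀ (n : ℕ) (M : ℝ), 2 * |1 / ((2 * 5 ^ n : ℕ) : ℝ)| * M = M / 5 ^ n := fun n M => by
    rw [abs_of_nonneg (by positivity)]
    push_cast
    field_simp
  -- The Laplacian has amplitude `L = 2 · 5 ^ n`, so its control constant is `2 L M₃ = 4 · 5 ^ n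
  -- M₃`; in the other two cases `2 / L = 1 / 5 ^ n`.
  refine ⟨M₁ + M₂ + 4 * M₃, by positivity, hs, fun n => ?_, fun n => ?_, fun n => ?_⟩
  · refine (hM₁ _ _ _ (5 ^ n) _ (hL n) (hR n) (hpat n) (hs n) (hv.periodic_v n)).mono ?_
      (by positivity)
    rw [hc]
    gcongr
    linarith
  · refine (hM₂ _ _ _ (5 ^ n) _ (hL n) (hR n) ((hpat n).eulerForce (hL n))
      ((hs n).eulerForce convex_univ huniv) (IsPeriodic.eulerForce (hv.periodic_v n))).mono ?_
      (by positivity)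
    rw [hc]
    gcongr
    linarith
  · refine (hM₃ _ _ _ (5 ^ n) _ (hL n) (hR n) ((hpat n).laplacian (hL n))
      ((hs n).laplacian convex_univ huniv) fun t ht => (hv.periodic_v n t ht).laplacian).mono ?_
      (by positivity)
    rw [abs_of_nonneg (by positivity)]
    push_cast
    have : (0 : ℝ) < 5 ^ n := by positivity
    nlinarith

/-! ### Hölder norms by interpolation -/

section HolderNorm

/-- With `u = R |x - y|`, the Lipschitz bound suffices if `u ≤ 1`, since then `u ≤ u ^ α`. If `u ≥
1`, the sup bound gives `2 A ≤ 2 A u ^ α`. -/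
theorem cHolderNorm_le {α : ℝ≥0} (hα : α ≤ 1) {f : Plane → Plane} {A R : ℝ} (hA : 0 ≤ A)
    (hR : 0 ≤ R) (h1 : ∀ x, ‖f x‖ ≤ A) (h2 : ∀ x y, ‖f x - f y‖ ≤ A * R * ‖x - y‖) :
    cHolderNorm α f ≤ ENNReal.ofReal (A + 2 * (A * R ^ (α : ℝ))) := by
  have hsup : (⨆ x, ‖f x‖ₑ) ≤ ENNReal.ofReal A := iSup_le fun x => by
    rw [← ofReal_norm]
    exact ENNReal.ofReal_le_ofReal (h1 x)
  have hC : 0 ≤ 2 * (A * R ^ (α : ℝ)) := by positivity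
  have hα' : (α : ℝ) ≤ 1 := by exact_mod_cast hα
  have hhol : HolderWith (2 * (A * R ^ (α : ℝ))).toNNReal α f := fun x y => by
    have hreal : dist (f x) (f y) ≤ 2 * (A * R ^ (α : ℝ)) * dist x y ^ (α : ℝ) := by
      rw [mul_assoc, mul_assoc, ← Real.mul_rpow hR dist_nonneg]
      have hu : 0 ≤ R * dist x y := by positivity
      rcases le_total (R * dist x y) 1 with hu1 | hu1
      · have h3 := Real.rpow_le_rpow_of_exponent_ge' hu hu1 α.coe_nonneg hα'
        rw [Real.rpow_one] at h3
        have h4 := h2 x y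
        rw [← dist_eq_norm, ← dist_eq_norm, mul_assoc] at h4
        have h5 := mul_le_mul_of_nonneg_left h3 hA
        have h6 : 0 ≤ A * (R * dist x y) := by positivity
        linarith
      · have h3 := Real.one_le_rpow hu1 α.coe_nonneg
        have h4 : dist (f x) (f y) ≤ A + A := by
          rw [dist_eq_norm]
          exact (norm_sub_le _ _).trans (add_le_add (h1 x) (h1 y))
        nlinarith
    rw [edist_dist, edist_dist, ENNReal.ofReal_rpow_of_nonneg dist_nonneg α.coe_nonneg,
      ← ENNReal.ofReal, ← ENNReal.ofReal_mul hC]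
    exact ENNReal.ofReal_le_ofReal hreal
  rw [ENNReal.ofReal_add hA hC]
  exact add_le_add hsup hhol.eHolderNorm_le

/-- Interpolating a sup bound `δ` with a fixed Lipschitz bound `B` gives a seminorm of order `δ ^ (1
- α) B ^ α`, which vanishes with `δ` because `α < 1`. -/
theorem tendsto_cHolderNorm_zero {ι : Type*} {l : Filter ι} {α : ℝ≥0} (hα : α < 1)
    {f : ι → Plane → Plane} {B : ℝ} (hB : ∀ᶠ i in l, ∀ x y, ‖f i x - f i y‖ ≤ B * ‖x - y‖)
    (h : ∀ ε > 0, ∀ᶠ i in l, ∀ x, ‖f i x‖ ≤ ε) :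
    Tendsto (fun i => cHolderNorm α (f i)) l (𝓝 0) := by
  rw [ENNReal.tendsto_nhds_zero]
  intro ε hε
  have hα' : (0 : ℝ) < 1 - α := sub_pos.2 (by exact_mod_cast hα)
  have hB0 : 0 ≤ max B 0 := le_max_right _ _
  have hlim : Tendsto (fun δ : ℝ => ENNReal.ofReal
      (δ + 2 * (δ ^ (1 - α : ℝ) * (max B 0) ^ (α : ℝ)))) (𝓝[>] 0) (𝓝 0) := by
    have h1 : Tendsto (fun δ : ℝ => δ ^ (1 - α : ℝ)) (𝓝 0) (𝓝 0) :=
      (Real.continuousAt_rpow_const 0 _ (Or.inr hα'.le)).tendsto.trans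
        (by rw [Real.zero_rpow hα'.ne'])
    have h2 : Tendsto (fun δ : ℝ => δ + 2 * (δ ^ (1 - α : ℝ) * (max B 0) ^ (α : ℝ)))
        (𝓝 0) (𝓝 (0 + 2 * (0 * (max B 0) ^ (α : ℝ)))) :=
      tendsto_id.add ((h1.mul_const _).const_mul 2)
    have h3 := (ENNReal.continuous_ofReal.tendsto _).comp h2
    simp only [zero_mul, mul_zero, add_zero, ENNReal.ofReal_zero] at h3
    exact h3.mono_left nhdsWithin_le_nhds
  obtain ⟨δ, hδε, hδ⟩ :=
    ((ENNReal.tendsto_nhds_zero.1 hlim ε hε).and self_mem_nhdsWithin).exists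
  have hδ : 0 < δ := hδ
  filter_upwards [hB, h δ hδ] with i hBi hi
  refine (cHolderNorm_le hα.le hδ.le (R := max B 0 / δ) (by positivity) hi fun x y => ?_).trans ?_
  · rw [mul_div_cancel₀ _ hδ.ne']
    exact (hBi x y).trans (mul_le_mul_of_nonneg_right (le_max_left _ _) (norm_nonneg _))
  · refine le_trans (le_of_eq ?_) hδε
    rw [Real.div_rpow hB0 hδ.le, Real.rpow_sub hδ, Real.rpow_one]
    congr 3
    ring

end HolderNorm

/-! ### The times `t_n` and gluing over epochs -/

section Times

theorem tn_zero : tn 0 = 0 := by simp [tn]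

theorem tn_lt_one (n : ℕ) : tn n < 1 := by
  unfold tn
  have : (0 : ℝ) < 1 / ((n : ℝ) + 1) ^ 2 := by positivity
  linarith

theorem strictMono_tn : StrictMono tn := by
  refine strictMono_nat_of_lt_succ fun n => ?_
  unfold tn
  push_cast
  gcongr
  linarith

theorem tn_nonneg (n : ℕ) : 0 ≤ tn n := tn_zero ▸ strictMono_tn.monotone (Nat.zero_le n)

theorem tendsto_tn : Tendsto tn atTop (𝓝 1) := by
  have h : Tendsto (fun n : ℕ => (1 : ℝ) - (1 / ((n : ℝ) + 1)) ^ 2) atTop (𝓝 (1 - 0 ^ 2)) :=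
    tendsto_const_nhds.sub (tendsto_one_div_add_atTop_nhds_zero_nat.pow 2)
  have h2 : tn = fun n : ℕ => (1 : ℝ) - (1 / ((n : ℝ) + 1)) ^ 2 := by
    funext n
    simp [tn]
  rw [h2]
  simpa using h

/-- The length of the `n`-th time interval. -/
noncomputable def gap (n : ℕ) : ℝ := tn (n + 1) - tn n

theorem gap_pos (n : ℕ) : 0 < gap n := sub_pos.2 (strictMono_tn n.lt_succ_self)

theorem one_div_gap_le (n : ℕ) : 1 / gap n ≤ 8 * ((n : ℝ) + 1) ^ 3 := by
  have h : gap n = (2 * n + 3) / (((n : ℝ) + 1) ^ 2 * (n + 2) ^ 2) := by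
    unfold gap tn
    push_cast
    field_simp
    ring
  rw [h, one_div_div, div_le_iff₀ (by positivity)]
  have h2 : ((n : ℝ) + 2) ^ 2 ≤ 8 * (n + 1) * (2 * n + 3) := by nlinarith [n.cast_nonneg (α := ℝ)]
  calc ((n : ℝ) + 1) ^ 2 * (n + 2) ^ 2 ≤ ((n : ℝ) + 1) ^ 2 * (8 * (n + 1) * (2 * n + 3)) := by
        gcongr
    _ = 8 * ((n : ℝ) + 1) ^ 3 * (2 * n + 3) := by ring

/-- The time left after epoch `n` is only polynomially small, so the geometric decay of the velocity
beats it in the difference quotient at `t = 1`. -/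
theorem one_sub_tn_succ (n : ℕ) : 1 ≤ 4 * ((n : ℝ) + 1) ^ 2 * (1 - tn (n + 1)) := by
  have h : 1 - tn (n + 1) = 1 / ((n : ℝ) + 2) ^ 2 := by
    unfold tn
    push_cast
    ring
  rw [h, mul_one_div, le_div_iff₀ (by positivity)]
  nlinarith [n.cast_nonneg (α := ℝ)]

/-- The `n`-th time interval `[t_n, t_{n+1}]`. -/
def epoch (n : ℕ) : Set ℝ := Icc (tn n) (tn (n + 1))

theorem epoch_subset_Ico (n : ℕ) : epoch n ⊆ Ico 0 1 := fun _ ht =>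
  ⟨(tn_nonneg n).trans ht.1, ht.2.trans_lt (tn_lt_one _)⟩

theorem epoch_subset_Icc (n : ℕ) : epoch n ⊆ Icc 0 1 :=
  (epoch_subset_Ico n).trans Ico_subset_Icc_self

theorem exists_lt_tn {t : ℝ} (ht : t < 1) : ∃ n, t < tn n :=
  (tendsto_tn.eventually_const_lt ht).exists

theorem exists_mem_Ico_tn {t : ℝ} (ht : t ∈ Ico (0 : ℝ) 1) :
    ∃ n, t ∈ Ico (tn n) (tn (n + 1)) := by
  classical
  have h := exists_lt_tn ht.2
  obtain ⟨n, hn⟩ : ∃ n, Nat.find h = n + 1 := Nat.exists_eq_succ_of_ne_zero fun h0 => by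
    have := Nat.find_spec h
    rw [h0, tn_zero] at this
    exact this.not_ge ht.1
  refine ⟨n, not_lt.1 (Nat.find_min h (by omega)), ?_⟩
  rw [← hn]
  exact Nat.find_spec h

theorem exists_mem_epoch {t : ℝ} (ht : t ∈ Ico (0 : ℝ) 1) : ∃ n, t ∈ epoch n :=
  (exists_mem_Ico_tn ht).imp fun _ h => Ico_subset_Icc_self h

theorem eq_tn_of_mem_epoch {t : ℝ} {n k : ℕ} (hn : t ∈ epoch n) (hk : t ∈ epoch k)
    (hnk : n ≠ k) : ∃ j, t = tn j := by
  rcases lt_or_gt_of_ne hnk with h | h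
  · exact ⟨k, le_antisymm (hn.2.trans (strictMono_tn.monotone h)) hk.1⟩
  · exact ⟨n, le_antisymm (hk.2.trans (strictMono_tn.monotone h)) hn.1⟩

/-- Near a time `s < 1` only finitely many epochs occur, and a closed epoch not containing `s` stays
away from it. At `s = t_n` with `n ≥ 1` the two adjacent epochs must both be checked. -/
theorem eventually_of_epochs {s : ℝ} (hs : s ∈ Ico (0 : ℝ) 1) {P : ℝ → Prop}
    (h : ∀ n, s ∈ epoch n → ∀ᶠ t in 𝓝[epoch n] s, P t) : ∀ᶠ t in 𝓝[Icc 0 1] s, P t := by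
  obtain ⟨N, hN⟩ := exists_lt_tn hs.2
  have hmem : (⋃ n ∈ Iio N, epoch n) ∈ 𝓝[Icc 0 1] s := by
    filter_upwards [self_mem_nhdsWithin, mem_nhdsWithin_of_mem_nhds (Iio_mem_nhds hN)]
      with t ht htN
    obtain ⟨n, hn⟩ := exists_mem_Ico_tn ⟨ht.1, lt_trans htN (tn_lt_one N)⟩
    exact mem_biUnion (show n ∈ Iio N from strictMono_tn.lt_iff_lt.1 (hn.1.trans_lt htN))
      (Ico_subset_Icc_self hn)
  refine Filter.Eventually.filter_mono (nhdsWithin_le_iff.2 hmem) ?_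
  rw [nhdsWithin_biUnion (finite_Iio N)]
  simp only [eventually_iSup]
  intro n _
  by_cases hn : s ∈ epoch n
  · exact h n hn
  · have hbot : 𝓝[epoch n] s = ⊥ := by
      rw [← notMem_closure_iff_nhdsWithin_eq_bot, epoch, isClosed_Icc.closure_eq]
      exact hn
    simp [hbot]

theorem eventually_exists_mem_epoch (N : ℕ) :
    ∀ᶠ t in 𝓝[Icc (0 : ℝ) 1] 1, t = 1 ∨ ∃ n, N ≤ n ∧ t ∈ epoch n := by
  filter_upwards [self_mem_nhdsWithin, mem_nhdsWithin_of_mem_nhds (Ioi_mem_nhds (tn_lt_one N))]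
    with t ht htN
  rcases eq_or_lt_of_le ht.2 with h | h
  · exact Or.inl h
  · obtain ⟨n, hn⟩ := exists_mem_Ico_tn ⟨ht.1, h⟩
    exact Or.inr ⟨n, Nat.lt_succ_iff.1 (strictMono_tn.lt_iff_lt.1 (lt_trans htN hn.2)),
      Ico_subset_Icc_self hn⟩

theorem hasDerivWithinAt_of_epochs {E : Type*} [NormedAddCommGroup E] [NormedSpace ℝ E]
    {f : ℝ → E} {f' : E} {s : ℝ} (hs : s ∈ Ico (0 : ℝ) 1)
    (h : ∀ n, s ∈ epoch n → HasDerivWithinAt f f' (epoch n) s) :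
    HasDerivWithinAt f f' (Icc 0 1) s := by
  rw [hasDerivWithinAt_iff_isLittleO, Asymptotics.isLittleO_iff]
  intro c hc
  exact eventually_of_epochs hs fun n hn =>
    (Asymptotics.isLittleO_iff.1 (hasDerivWithinAt_iff_isLittleO.1 (h n hn))) hc

end Times

/-! ### Estimates for the time change -/

/-- The second derivative of the time change. -/
noncomputable def accel (η : ℝ → ℝ) (t : ℝ) : ℝ :=
  derivWithin (derivWithin η (Ico 0 1)) (Ico 0 1) t

/-- The rescaled time `(η(t) - t_n) / (t_{n+1} - t_n)`. -/
noncomputable def phase (η : ℝ → ℝ) (n : ℕ) (t : ℝ) : ℝ := (η t - tn n) / gap n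

/-- The time derivative of the rescaled time. -/
noncomputable def rate (η : ℝ → ℝ) (n : ℕ) (t : ℝ) : ℝ := derivWithin η (Ico 0 1) t / gap n

namespace IsTimeChange

variable {η : ℝ → ℝ}

theorem uniqueDiffOn : UniqueDiffOn ℝ (Ico (0 : ℝ) 1) := uniqueDiffOn_Ico 0 1

theorem smooth_deriv (hη : IsTimeChange η) :
    ContDiffOn ℝ ∞ (derivWithin η (Ico 0 1)) (Ico 0 1) :=
  hη.smooth.derivWithin uniqueDiffOn (by simp)

theorem hasDerivWithinAt (hη : IsTimeChange η) {t : ℝ} (ht : t ∈ Ico (0 : ℝ) 1) :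
    HasDerivWithinAt η (derivWithin η (Ico 0 1) t) (Ico 0 1) t :=
  (hη.smooth.differentiableOn (by simp) t ht).hasDerivWithinAt

theorem hasDerivWithinAt_deriv (hη : IsTimeChange η) {t : ℝ} (ht : t ∈ Ico (0 : ℝ) 1) :
    HasDerivWithinAt (derivWithin η (Ico 0 1)) (accel η t) (Ico 0 1) t :=
  (hη.smooth_deriv.differentiableOn (by simp) t ht).hasDerivWithinAt

theorem continuousOn_accel (hη : IsTimeChange η) : ContinuousOn (accel η) (Ico 0 1) :=
  (hη.smooth_deriv.derivWithin (m := ∞) uniqueDiffOn (by simp)).continuousOn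

theorem iteratedDerivWithin_two (t : ℝ) :
    iteratedDerivWithin 2 η (Ico 0 1) t = accel η t := by
  rw [iteratedDerivWithin_succ, iteratedDerivWithin_one, accel]

theorem deriv_tn (hη : IsTimeChange η) (n : ℕ) : derivWithin η (Ico 0 1) (tn n) = 0 := by
  rw [← iteratedDerivWithin_one]
  exact hη.flat n 1 le_rfl

theorem accel_tn (hη : IsTimeChange η) (n : ℕ) : accel η (tn n) = 0 := by
  rw [← iteratedDerivWithin_two]
  exact hη.flat n 2 (by norm_num)

theorem rate_tn (hη : IsTimeChange η) (n k : ℕ) : rate η k (tn n) = 0 := by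
  rw [rate, hη.deriv_tn, zero_div]

theorem apply_mem_epoch (hη : IsTimeChange η) {n : ℕ} {t : ℝ} (ht : t ∈ epoch n) :
    η t ∈ epoch n := by
  have hmem : ∀ k, tn k ∈ Icc (0 : ℝ) 1 := fun k => ⟨tn_nonneg k, (tn_lt_one k).le⟩
  have ht' := epoch_subset_Icc n ht
  constructor
  · rw [← hη.fixes n]
    exact hη.monotone (hmem n) ht' ht.1
  · rw [← hη.fixes (n + 1)]
    exact hη.monotone ht' (hmem (n + 1)) ht.2

/-- No continuity at `1` is assumed: monotonicity gives `t_n = η(t_n) ≤ η(1) ≤ 1` for all `n`. -/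
theorem apply_one (hη : IsTimeChange η) : η 1 = 1 := by
  have h1 : (1 : ℝ) ∈ Icc (0 : ℝ) 1 := ⟨zero_le_one, le_rfl⟩
  refine le_antisymm (hη.mapsTo h1).2 (le_of_tendsto' tendsto_tn fun n => ?_)
  rw [← hη.fixes n]
  exact hη.monotone ⟨tn_nonneg n, (tn_lt_one n).le⟩ h1 (tn_lt_one n).le

theorem phase_mem (hη : IsTimeChange η) {n : ℕ} {t : ℝ} (ht : t ∈ epoch n) :
    phase η n t ∈ Icc (0 : ℝ) 1 := by
  obtain ⟨h1, h2⟩ := hη.apply_mem_epoch ht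
  have hg := gap_pos n
  refine ⟨div_nonneg (sub_nonneg.2 h1) hg.le, (div_le_one hg).2 ?_⟩
  unfold gap
  linarith

theorem hasDerivWithinAt_phase (hη : IsTimeChange η) {n : ℕ} {t : ℝ} (ht : t ∈ epoch n) :
    HasDerivWithinAt (phase η n) (rate η n t) (epoch n) t :=
  (((hη.hasDerivWithinAt (epoch_subset_Ico n ht)).mono (epoch_subset_Ico n)).sub_const
    (tn n)).div_const (gap n)

theorem hasDerivWithinAt_rate (hη : IsTimeChange η) {n : ℕ} {t : ℝ} (ht : t ∈ epoch n) :
    HasDerivWithinAt (rate η n) (accel η t / gap n) (epoch n) t :=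
  ((hη.hasDerivWithinAt_deriv (epoch_subset_Ico n ht)).mono (epoch_subset_Ico n)).div_const (gap n)

/-- `η` may reach `t_{n+1}` before time `t_{n+1}`, which already moves the indicator on to the next
stage. Monotonicity then makes `η` constant for the rest of the epoch, so the velocity vanishes
there. -/
theorem deriv_eq_zero_of_apply_eq (hη : IsTimeChange η) {n : ℕ} {t : ℝ} (ht : t ∈ epoch n)
    (h : η t = tn (n + 1)) : derivWithin η (Ico 0 1) t = 0 := by
  rcases eq_or_lt_of_le ht.2 with heq | hlt
  · rw [heq]
    exact hη.deriv_tn (n + 1)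
  · have hsub : Icc t (tn (n + 1)) ⊆ Ico 0 1 := fun s hs =>
      epoch_subset_Ico n ⟨ht.1.trans hs.1, hs.2⟩
    have htt : t ∈ Icc t (tn (n + 1)) := ⟨le_rfl, hlt.le⟩
    have hconst : HasDerivWithinAt η 0 (Icc t (tn (n + 1))) t := by
      refine (hasDerivWithinAt_const t (Icc t (tn (n + 1))) (tn (n + 1))).congr (fun s hs => ?_) h
      refine le_antisymm (hη.apply_mem_epoch ⟨ht.1.trans hs.1, hs.2⟩).2 ?_
      rw [← h]
      exact hη.monotone (Ico_subset_Icc_self (hsub htt)) (Ico_subset_Icc_self (hsub hs)) hs.1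
    exact (uniqueDiffOn_Icc hlt t htt).eq_deriv _
      ((hη.hasDerivWithinAt (hsub htt)).mono hsub) hconst

/-- Each division by the gap costs `(n + 1) ^ 3`, so the rate has exponent `5 + 3 = 8`. Its square
has exponent `16`, which dominates `10 + 3 = 13` from the second derivative. The assumed bounds omit
the right end point, where flatness is used instead. -/
theorem exists_bounds (hη : IsTimeChange η) : ∃ K : ℝ, 0 ≤ K ∧ ∀ n, ∀ t ∈ epoch n,
    |rate η n t| ≤ K * ((n : ℝ) + 1) ^ 8 ∧
    |accel η t / gap n| + rate η n t ^ 2 ≤ K * ((n : ℝ) + 1) ^ 16 := by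
  obtain ⟨C₁, h₁⟩ := hη.bound 1
  obtain ⟨C₂, h₂⟩ := hη.bound 2
  set C := |C₁| + |C₂| with hC
  have hC0 : 0 ≤ C := by positivity
  have hd : ∀ n, ∀ t ∈ epoch n, |derivWithin η (Ico 0 1) t| ≤ C * ((n : ℝ) + 1) ^ 5 := by
    intro n t ht
    rcases eq_or_lt_of_le ht.2 with heq | hlt
    · rw [heq, hη.deriv_tn, abs_zero]
      positivity
    · have h := h₁ n t ⟨ht.1, hlt⟩
      rw [iteratedDerivWithin_one] at h
      refine h.trans (mul_le_mul_of_nonneg_right ?_ (by positivity))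
      linarith [le_abs_self C₁, abs_nonneg C₂]
  have ha : ∀ n, ∀ t ∈ epoch n, |accel η t| ≤ C * ((n : ℝ) + 1) ^ 10 := by
    intro n t ht
    rcases eq_or_lt_of_le ht.2 with heq | hlt
    · rw [heq, hη.accel_tn, abs_zero]
      positivity
    · have h := h₂ n t ⟨ht.1, hlt⟩
      rw [iteratedDerivWithin_two] at h
      refine h.trans (mul_le_mul_of_nonneg_right ?_ (by positivity))
      linarith [le_abs_self C₂, abs_nonneg C₁]
  refine ⟨8 * C + 64 * C ^ 2, by positivity, fun n t ht => ?_⟩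
  have hn : (1 : ℝ) ≤ (n : ℝ) + 1 := by linarith [n.cast_nonneg (α := ℝ)]
  have hg := one_div_gap_le n
  have hg0 : 0 ≤ 1 / gap n := (one_div_pos.2 (gap_pos n)).le
  have hrate : |rate η n t| ≤ 8 * C * ((n : ℝ) + 1) ^ 8 := by
    rw [rate, div_eq_mul_one_div, abs_mul, abs_of_nonneg hg0]
    calc _ ≤ C * ((n : ℝ) + 1) ^ 5 * (8 * ((n : ℝ) + 1) ^ 3) :=
          mul_le_mul (hd n t ht) hg hg0 (by positivity)
      _ = _ := by ring
  have hacc : |accel η t / gap n| ≤ 8 * C * ((n : ℝ) + 1) ^ 13 := by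
    rw [div_eq_mul_one_div, abs_mul, abs_of_nonneg hg0]
    calc _ ≤ C * ((n : ℝ) + 1) ^ 10 * (8 * ((n : ℝ) + 1) ^ 3) :=
          mul_le_mul (ha n t ht) hg hg0 (by positivity)
      _ = _ := by ring
  constructor
  · refine hrate.trans (mul_le_mul_of_nonneg_right ?_ (by positivity))
    linarith [sq_nonneg C]
  · have h1 : rate η n t ^ 2 ≤ (8 * C * ((n : ℝ) + 1) ^ 8) ^ 2 := by
      rw [← sq_abs]
      gcongr
    have h2 : 8 * C * ((n : ℝ) + 1) ^ 13 ≤ 8 * C * ((n : ℝ) + 1) ^ 16 :=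
      mul_le_mul_of_nonneg_left (pow_le_pow_right₀ hn (by norm_num)) (by positivity)
    calc _ ≤ 8 * C * ((n : ℝ) + 1) ^ 16 + (8 * C * ((n : ℝ) + 1) ^ 8) ^ 2 :=
          add_le_add (hacc.trans h2) h1
      _ = _ := by ring

end IsTimeChange

/-! ### The velocity and its force, epoch by epoch -/

section Velocity

variable {η : ℝ → ℝ} {w : ℕ → Plane → ℝ → Plane} {M : ℝ} {D : ℕ → ℝ}

/-- The factor `η'(1)` is not controlled; the field vanishes because `η(1) = 1` lies in no interval
`[t_n, t_{n+1})`. -/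
theorem velocity_one (hη : IsTimeChange η) (x : Plane) : velocity w η x 1 = 0 := by
  have h : ∀ n, stage w n x (η 1) = 0 := fun n => by
    rw [hη.apply_one, stage, indicator_of_notMem fun h => (tn_lt_one (n + 1)).not_gt h.2]
  simp [velocity, h]

/-- This holds on the closed epoch although the stages live on half-open intervals: when `η(t) =
t_{n+1}` the derivative of `η` is zero and both sides vanish. -/
theorem velocity_eq (hη : IsTimeChange η) {n : ℕ} {t : ℝ} (ht : t ∈ epoch n) (x : Plane) :
    velocity w η x t = rate η n t • w n x (phase η n t) := by
  obtain ⟨h1, h2⟩ := hη.apply_mem_epoch ht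
  rcases eq_or_lt_of_le h2 with heq | hlt
  · simp [velocity, rate, hη.deriv_eq_zero_of_apply_eq ht heq]
  · have hne : ∀ k, k ≠ n → stage w k x (η t) = 0 := fun k hk => by
      rw [stage, indicator_of_notMem]
      intro hmem
      rcases lt_or_gt_of_ne hk with h | h
      · exact (hmem.2.trans_le ((strictMono_tn.monotone h).trans h1)).false
      · exact (hlt.trans_le ((strictMono_tn.monotone h).trans hmem.1)).false
    rw [velocity, tsum_eq_single n hne, stage, 
      indicator_of_mem (show η t ∈ Ico (tn n) (tn (n + 1)) from ⟨h1, hlt⟩), smul_smul, rate,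
      phase, gap, mul_one_div]

/-- Truncating the sum amounts to replacing the later fields by zero, so every result about
`velocity` applies to the truncated fields as well. -/
theorem velocityTrunc_eq_velocity (v : ℕ → Plane → ℝ → Plane) (η : ℝ → ℝ) (m : ℕ) :
    velocityTrunc v η m = velocity (fun n x t => if n ≤ m then v n x t else 0) η := by
  funext x t
  unfold velocity velocityTrunc
  rw [tsum_eq_sum (s := Finset.range (m + 1))]
  · congr 1
    refine Finset.sum_congr rfl fun n hn => ?_
    have hn : n ≤ m := Nat.lt_succ_iff.1 (Finset.mem_range.1 hn)
    simp [stage, hn]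
  · intro n hn
    have hn : ¬ n ≤ m := fun h => hn (Finset.mem_range.2 (Nat.lt_succ_iff.2 h))
    simp [stage, hn]

/-- Product and chain rule within each epoch. At a time shared by two epochs both one-sided
derivatives are zero, since the rate and the second derivative of `η` vanish there. -/
theorem hasDerivWithinAt_velocity (hη : IsTimeChange η) (hw : ∀ n, SmoothUpTo univ (w n))
    {n : ℕ} {t : ℝ} (ht : t ∈ epoch n) (x : Plane) :
    HasDerivWithinAt (velocity w η x) ((accel η t / gap n) • w n x (phase η n t) +
      rate η n t ^ 2 • timeDeriv (w n) x (phase η n t)) (Icc 0 1) t := by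
  refine hasDerivWithinAt_of_epochs (epoch_subset_Ico n ht) fun k hk => ?_
  have h1 : HasDerivWithinAt (w k x) (timeDeriv (w k) x (phase η k t)) (Icc 0 1) (phase η k t) :=
    ((hw k).differentiableOn_time x _ (hη.phase_mem hk)).hasDerivWithinAt
  have h2 := h1.scomp t (hη.hasDerivWithinAt_phase hk) fun s hs => hη.phase_mem hs
  have h3 := (hη.hasDerivWithinAt_rate hk).smul h2
  have h4 : HasDerivWithinAt (velocity w η x) _ (epoch k) t :=
    h3.congr (fun s hs => velocity_eq hη hs x) (velocity_eq hη hk x)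
  suffices heq : (accel η t / gap n) • w n x (phase η n t) +
      rate η n t ^ 2 • timeDeriv (w n) x (phase η n t) =
      rate η k t • rate η k t • timeDeriv (w k) x (phase η k t) +
      (accel η t / gap k) • (w k x ∘ phase η k) t by
    rw [heq]
    exact h4
  rcases eq_or_ne n k with rfl | hnk
  · rw [smul_smul, add_comm, sq]
    rfl
  · obtain ⟨j, rfl⟩ := eq_tn_of_mem_epoch ht hk hnk
    simp [hη.rate_tn, hη.accel_tn]

theorem tendsto_pow_mul_geometric (k : ℕ) {q : ℝ} (hq0 : 0 < q) (hq1 : q < 1) :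
    Tendsto (fun n : ℕ => ((n : ℝ) + 1) ^ k * q ^ n) atTop (𝓝 0) := by
  have h := ((tendsto_pow_const_mul_const_pow_of_abs_lt_one k
    (by rwa [abs_of_pos hq0])).comp (tendsto_add_atTop_nat 1)).const_mul q⁻¹
  rw [mul_zero] at h
  refine h.congr fun n => ?_
  simp only [Function.comp_apply, Nat.cast_add, Nat.cast_one, pow_succ q]
  field_simp

/-- In epoch `n` the velocity is of order `(n + 1) ^ 8 5 ^ (-n)` while `1 - t` is at least of order
`(n + 1) ^ (-2)`; the difference quotient is thus of order `(n + 1) ^ 10 5 ^ (-n)`. -/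
theorem IsControlledFamily.hasDerivWithinAt_velocity_one (hη : IsTimeChange η)
    (hw : IsControlledFamily M D w) (x : Plane) :
    HasDerivWithinAt (velocity w η x) 0 (Icc 0 1) 1 := by
  obtain ⟨K, hK0, hK⟩ := hη.exists_bounds
  have hlim := (tendsto_pow_mul_geometric 10 (q := 1 / 5) (by norm_num) (by norm_num)).const_mul
    (4 * K * |M|)
  rw [mul_zero] at hlim
  rw [hasDerivWithinAt_iff_isLittleO, Asymptotics.isLittleO_iff]
  intro c hc
  obtain ⟨N, hN⟩ := eventually_atTop.1 (hlim.eventually_le_const hc)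
  filter_upwards [eventually_exists_mem_epoch N] with t ht
  rcases ht with rfl | ⟨n, hn, ht⟩
  · simp
  · have h3 : 0 ≤ 1 - t := by linarith [ht.2, tn_lt_one (n + 1)]
    rw [velocity_one hη, sub_zero, smul_zero, sub_zero, velocity_eq hη ht, norm_smul,
      Real.norm_eq_abs, Real.norm_eq_abs, abs_sub_comm, abs_of_nonneg h3]
    have h1 : 1 ≤ 4 * ((n : ℝ) + 1) ^ 2 * (1 - t) :=
      (one_sub_tn_succ n).trans (mul_le_mul_of_nonneg_left (by linarith [ht.2]) (by positivity))
    have h2 : ‖w n x (phase η n t)‖ ≤ |M| * (1 / 5) ^ n := by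
      refine ((hw.self n).norm_le _ (hη.phase_mem ht) x).trans ?_
      rw [one_div, inv_pow, ← div_eq_mul_inv]
      gcongr
      exact le_abs_self M
    calc |rate η n t| * ‖w n x (phase η n t)‖
        ≤ K * ((n : ℝ) + 1) ^ 8 * (|M| * (1 / 5) ^ n) :=
          mul_le_mul (hK n t ht).1 h2 (norm_nonneg _) (by positivity)
      _ ≤ K * ((n : ℝ) + 1) ^ 8 * (|M| * (1 / 5) ^ n) * (4 * ((n : ℝ) + 1) ^ 2 * (1 - t)) :=
          le_mul_of_one_le_right (by positivity) h1
      _ = 4 * K * |M| * (((n : ℝ) + 1) ^ 10 * (1 / 5) ^ n) * (1 - t) := by ring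
      _ ≤ c * (1 - t) := mul_le_mul_of_nonneg_right (hN n hn) h3

theorem IsControlledFamily.hasClassicalDerivatives (hη : IsTimeChange η)
    (hw : IsControlledFamily M D w) : HasClassicalDerivatives (velocity w η) := by
  constructor
  · intro t ht
    rcases eq_or_lt_of_le ht.2 with rfl | hlt
    · simp only [velocity_one hη]
      exact contDiff_const
    · obtain ⟨n, hn⟩ := exists_mem_epoch ⟨ht.1, hlt⟩
      simp only [velocity_eq hη hn]
      exact ((hw.smooth n).contDiff_space (hη.phase_mem hn)).const_smul _
  · intro x t ht
    rcases eq_or_lt_of_le ht.2 with rfl | hlt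
    · exact (hw.hasDerivWithinAt_velocity_one hη x).differentiableWithinAt
    · obtain ⟨n, hn⟩ := exists_mem_epoch ⟨ht.1, hlt⟩
      exact (hasDerivWithinAt_velocity hη hw.smooth hn x).differentiableWithinAt

/-- The force of the velocity field during the `n`-th time interval. -/
noncomputable def epochForce (ν : ℝ) (w : ℕ → Plane → ℝ → Plane) (η : ℝ → ℝ) (n : ℕ) (x : Plane)
    (t : ℝ) : Plane :=
  (accel η t / gap n) • w n x (phase η n t) + rate η n t ^ 2 • eulerForce (w n) x (phase η n t) -
    (ν * rate η n t) • Laplacian.laplacian (fun y => w n y (phase η n t)) x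

/-- The chain rule in time and the quadratic transport term both produce the square of the rate, so
the two combine into the Euler force of `w n`. -/
theorem nsForce_velocity_eq (hη : IsTimeChange η) (hw : ∀ n, SmoothUpTo univ (w n)) (ν : ℝ)
    {n : ℕ} {t : ℝ} (ht : t ∈ epoch n) (x : Plane) :
    nsForce ν (velocity w η) x t = epochForce ν w η n x t := by
  have hs := (hw n).contDiff_space (hη.phase_mem ht)
  have hs2 : ContDiff ℝ 2 fun y => w n y (phase η n t) := by
    exact_mod_cast contDiff_infty.1 hs 2
  have h1 : (fun y => velocity w η y t) = rate η n t • fun y => w n y (phase η n t) :=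
    funext fun y => velocity_eq hη ht y
  have h2 := (hasDerivWithinAt_velocity hη hw ht x).derivWithin
    (uniqueDiffOn_Icc zero_lt_one t (epoch_subset_Icc n ht))
  unfold nsForce eulerForce epochForce
  rw [h1, h2, velocity_eq hη ht, fderiv_const_smul_field,
    InnerProductSpace.laplacian_smul _ hs2.contDiffAt]
  simp only [eulerForce_eq, timeDeriv, spaceDeriv, Pi.smul_apply, _root_.smul_apply, map_smul,
    smul_add, smul_smul, sq]
  rw [add_assoc]

theorem IsControlledFamily.nsForce_velocity_one (hη : IsTimeChange η)
    (hw : IsControlledFamily M D w) (ν : ℝ) (x : Plane) :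
    nsForce ν (velocity w η) x 1 = 0 := by
  have h1 : (fun y => velocity w η y 1) = fun _ => 0 := funext fun y => velocity_one hη y
  have h2 := (hw.hasDerivWithinAt_velocity_one hη x).derivWithin
    (uniqueDiffOn_Icc zero_lt_one 1 ⟨zero_le_one, le_rfl⟩)
  unfold nsForce eulerForce
  rw [h1, h2, velocity_one hη]
  simp

theorem nsForce_zero (u : Plane → ℝ → Plane) : nsForce 0 u = eulerForce u := by
  funext x t
  simp [nsForce]

end Velocity

/-! ### Hölder estimates and continuity of the forces -/

section Forces

variable {η : ℝ → ℝ} {w : ℕ → Plane → ℝ → Plane} {M : ℝ} {D : ℕ → ℝ} {α : ℝ≥0}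

/-- Continuity in time, uniformly in space, of a controlled field composed with a change of time
and multiplied by a continuous coefficient. -/
theorem Controlled.tendstoUniformly_smul {A R : ℝ} {f : Plane → ℝ → Plane} (hf : Controlled A R f)
    {c p : ℝ → ℝ} {S : Set ℝ} {s : ℝ} (hs : s ∈ S) (hc : ContinuousWithinAt c S s)
    (hp : ContinuousWithinAt p S s) (hpS : ∀ t ∈ S, p t ∈ Icc (0 : ℝ) 1) :
    TendstoUniformly (fun t x => c t • f x (p t)) (fun x => c s • f x (p s)) (𝓝[S] s) := by
  rw [Metric.tendstoUniformly_iff]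
  intro ε hε
  have hlim : Tendsto (fun t => |c t - c s| * A + |c s| * (A * |p t - p s|)) (𝓝[S] s) (𝓝 0) := by
    have h1 : Tendsto (fun t => |c t - c s|) (𝓝[S] s) (𝓝 0) := by
      simpa using (hc.tendsto.sub_const (c s)).abs
    have h2 : Tendsto (fun t => |p t - p s|) (𝓝[S] s) (𝓝 0) := by
      simpa using (hp.tendsto.sub_const (p s)).abs
    simpa using (h1.mul_const A).add ((h2.const_mul A).const_mul |c s|)
  filter_upwards [hlim.eventually_lt_const hε, self_mem_nhdsWithin] with t ht htS x
  refine lt_of_le_of_lt ?_ ht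
  rw [dist_comm, dist_eq_norm]
  have h : c t • f x (p t) - c s • f x (p s) =
      (c t - c s) • f x (p t) + c s • (f x (p t) - f x (p s)) := by module
  rw [h]
  refine (norm_add_le _ _).trans (add_le_add ?_ ?_)
  · rw [norm_smul, Real.norm_eq_abs]
    exact mul_le_mul_of_nonneg_left (hf.norm_le _ (hpS t htS) x) (abs_nonneg _)
  · rw [norm_smul, Real.norm_eq_abs]
    exact mul_le_mul_of_nonneg_left (hf.time _ (hpS s hs) _ (hpS t htS) x) (abs_nonneg _)

theorem IsControlledFamily.tendstoUniformly_nsForce (hη : IsTimeChange η)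
    (hw : IsControlledFamily M D w) (ν : ℝ) {n : ℕ} {s : ℝ} (hs : s ∈ epoch n) :
    TendstoUniformly (fun t x => nsForce ν (velocity w η) x t)
      (fun x => nsForce ν (velocity w η) x s) (𝓝[epoch n] s) := by
  have hr := (hη.hasDerivWithinAt_rate hs).continuousWithinAt
  have hp := (hη.hasDerivWithinAt_phase hs).continuousWithinAt
  have ha : ContinuousWithinAt (fun t => accel η t / gap n) (epoch n) s :=
    ((hη.continuousOn_accel s (epoch_subset_Ico n hs)).mono (epoch_subset_Ico n)).div_const _
  have hmem := fun t (ht : t ∈ epoch n) => hη.phase_mem ht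
  have h := (((hw.self n).tendstoUniformly_smul hs ha hp hmem).add
    ((hw.euler n).tendstoUniformly_smul hs (hr.pow 2) hp hmem)).sub
    ((hw.laplacian n).tendstoUniformly_smul hs (hr.const_mul ν) hp hmem)
  intro u hu
  filter_upwards [h u hu, self_mem_nhdsWithin] with t h1 ht x
  rw [nsForce_velocity_eq hη hw.smooth ν hs, nsForce_velocity_eq hη hw.smooth ν ht]
  exact h1 x

/-- The force is periodic in space at every time. -/
theorem IsControlledFamily.periodic_nsForce (hη : IsTimeChange η)
    (hw : IsControlledFamily M D w) (ν : ℝ) {t : ℝ} (ht : t ∈ Icc (0 : ℝ) 1) :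
    IsPeriodic fun x => nsForce ν (velocity w η) x t := by
  intro x i
  rcases eq_or_lt_of_le ht.2 with rfl | hlt
  · simp only [hw.nsForce_velocity_one hη]
  · obtain ⟨n, hn⟩ := exists_mem_epoch ⟨ht.1, hlt⟩
    have hp := hη.phase_mem hn
    have h1 := (hw.self n).periodic _ hp x i
    have h2 := (hw.euler n).periodic _ hp x i
    have h3 := (hw.laplacian n).periodic _ hp x i
    simp only [nsForce_velocity_eq hη hw.smooth ν hn, epochForce] at *
    rw [h1, h2, h3]

/-- `K` depends on `η` only, hence serves all truncations and viscosities at once. The viscous term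
is also bounded separately, because in the epochs `n ≤ m` it is all that remains of `g^m - g`. -/
theorem IsTimeChange.exists_epochForce_bounds (hη : IsTimeChange η) :
    ∃ K : ℝ, 0 ≤ K ∧ ∀ (w : ℕ → Plane → ℝ → Plane) (M : ℝ) (D : ℕ → ℝ), 0 ≤ M → (∀ n, 0 ≤ D n) →
      IsControlledFamily M D w → ∀ (ν : ℝ) (n : ℕ), ∀ t ∈ epoch n,
      (∀ x, ‖epochForce ν w η n x t‖ ≤ K * ((n : ℝ) + 1) ^ 16 * (M / 5 ^ n + |ν| * D n)) ∧
      (∀ x y, ‖epochForce ν w η n x t - epochForce ν w η n y t‖ ≤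
        K * ((n : ℝ) + 1) ^ 16 * (M / 5 ^ n + |ν| * D n) * 5 ^ n * ‖x - y‖) ∧
      (∀ x, ‖(ν * rate η n t) • Laplacian.laplacian (fun z => w n z (phase η n t)) x‖ ≤
        K * ((n : ℝ) + 1) ^ 16 * (|ν| * D n)) ∧
      (∀ x y, ‖(ν * rate η n t) • Laplacian.laplacian (fun z => w n z (phase η n t)) x -
          (ν * rate η n t) • Laplacian.laplacian (fun z => w n z (phase η n t)) y‖ ≤
        K * ((n : ℝ) + 1) ^ 16 * (|ν| * D n) * 5 ^ n * ‖x - y‖) := by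
  obtain ⟨K, hK0, hK⟩ := hη.exists_bounds
  refine ⟨K, hK0, fun w M D hM hD hw ν n t ht => ?_⟩
  obtain ⟨h1, h2⟩ := hK n t ht
  have hp := hη.phase_mem ht
  have hn : (1 : ℝ) ≤ (n : ℝ) + 1 := by linarith [n.cast_nonneg (α := ℝ)]
  have h3 : |rate η n t| ≤ K * ((n : ℝ) + 1) ^ 16 :=
    h1.trans (mul_le_mul_of_nonneg_left (pow_le_pow_right₀ hn (by norm_num)) hK0)
  have hcoef : ∀ {a b : Plane} {P : ℝ}, 0 ≤ P → ‖a‖ ≤ P → ‖b‖ ≤ P →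
      ‖(accel η t / gap n) • a + rate η n t ^ 2 • b‖ ≤ K * ((n : ℝ) + 1) ^ 16 * P := by
    intro a b P hP ha hb
    calc _ ≤ |accel η t / gap n| * ‖a‖ + rate η n t ^ 2 * ‖b‖ := by
          refine (norm_add_le _ _).trans (le_of_eq ?_)
          rw [norm_smul, norm_smul, Real.norm_eq_abs, Real.norm_eq_abs, abs_sq]
      _ ≤ |accel η t / gap n| * P + rate η n t ^ 2 * P := by gcongr
      _ = (|accel η t / gap n| + rate η n t ^ 2) * P := by ring
      _ ≤ _ := mul_le_mul_of_nonneg_right h2 hP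
  have hvisc : ∀ {c : Plane} {Q : ℝ}, ‖c‖ ≤ Q →
      ‖(ν * rate η n t) • c‖ ≤ K * ((n : ℝ) + 1) ^ 16 * (|ν| * Q) := by
    intro c Q hc
    rw [norm_smul, Real.norm_eq_abs, abs_mul]
    calc |ν| * |rate η n t| * ‖c‖ ≤ |ν| * (K * ((n : ℝ) + 1) ^ 16) * Q := by gcongr
      _ = _ := by ring
  have hvisc_lip : ∀ x y,
      ‖(ν * rate η n t) • Laplacian.laplacian (fun z => w n z (phase η n t)) x -
        (ν * rate η n t) • Laplacian.laplacian (fun z => w n z (phase η n t)) y‖ ≤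
      K * ((n : ℝ) + 1) ^ 16 * (|ν| * D n) * 5 ^ n * ‖x - y‖ := fun x y => by
    rw [← smul_sub]
    refine (hvisc ((hw.laplacian n).space _ hp x y)).trans (le_of_eq ?_)
    ring
  refine ⟨fun x => ?_, fun x y => ?_, fun x => hvisc ((hw.laplacian n).norm_le _ hp x), hvisc_lip⟩
  · rw [mul_add]
    refine (norm_sub_le _ _).trans (add_le_add ?_ (hvisc ((hw.laplacian n).norm_le _ hp x)))
    exact hcoef (by positivity) ((hw.self n).norm_le _ hp x)
      ((hw.euler n).norm_le _ hp x)
  · have hsplit : epochForce ν w η n x t - epochForce ν w η n y t =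
        ((accel η t / gap n) • (w n x (phase η n t) - w n y (phase η n t)) +
          rate η n t ^ 2 • (eulerForce (w n) x (phase η n t) - eulerForce (w n) y (phase η n t))) -
        ((ν * rate η n t) • Laplacian.laplacian (fun z => w n z (phase η n t)) x -
          (ν * rate η n t) • Laplacian.laplacian (fun z => w n z (phase η n t)) y) := by
      unfold epochForce
      module
    rw [hsplit, mul_add, add_mul, add_mul]
    refine (norm_sub_le _ _).trans (add_le_add ?_ (hvisc_lip x y))
    refine (hcoef (by positivity) ((hw.self n).space _ hp x y)
      ((hw.euler n).space _ hp x y)).trans (le_of_eq ?_)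
    ring

/-- The Hölder norm of a field oscillating at the scale `5 ^ (-n)`. -/
theorem cHolderNorm_le_of_scale (hα : α ≤ 1) {f : Plane → Plane} {A : ℝ} {n : ℕ} (hA : 0 ≤ A)
    (h1 : ∀ x, ‖f x‖ ≤ A) (h2 : ∀ x y, ‖f x - f y‖ ≤ A * 5 ^ n * ‖x - y‖) :
    cHolderNorm α f ≤ ENNReal.ofReal (3 * (A * ((5 : ℝ) ^ n) ^ (α : ℝ))) := by
  refine (cHolderNorm_le hα hA (by positivity) h1 h2).trans (ENNReal.ofReal_le_ofReal ?_)
  have h : 1 ≤ ((5 : ℝ) ^ n) ^ (α : ℝ) :=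
    Real.one_le_rpow (one_le_pow₀ (by norm_num)) α.coe_nonneg
  nlinarith

theorem cHolderNorm_zero : cHolderNorm α (fun _ => 0) = 0 := by
  have h : eHolderNorm α (fun _ : Plane => (0 : Plane)) = 0 := eHolderNorm_zero Plane α
  simp [cHolderNorm, h]

/-- At `t = 1` continuity comes from the decay of the epochwise Hölder norms. Before that, uniform
convergence is upgraded to `C^α` convergence by a Lipschitz bound common to nearby times. -/
theorem memCTimeHolder_of_epochs (hα : α < 1) {f : Plane → ℝ → Plane} {A : ℕ → ℝ}
    (hper : ∀ t ∈ Icc (0 : ℝ) 1, IsPeriodic fun x => f x t) (hone : ∀ x, f x 1 = 0)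
    (hA : ∀ n, 0 ≤ A n) (hnorm : ∀ n, ∀ t ∈ epoch n, ∀ x, ‖f x t‖ ≤ A n)
    (hlip : ∀ n, ∀ t ∈ epoch n, ∀ x y, ‖f x t - f y t‖ ≤ A n * 5 ^ n * ‖x - y‖)
    (hcont : ∀ n, ∀ s ∈ epoch n, TendstoUniformly (fun t x => f x t) (fun x => f x s) (𝓝[epoch n] s))
    (hlim : Tendsto (fun n => A n * ((5 : ℝ) ^ n) ^ (α : ℝ)) atTop (𝓝 0)) :
    MemCTimeHolder α f := by
  have hbound : ∀ n, ∀ t ∈ epoch n, cHolderNorm α (fun x => f x t) ≤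
      ENNReal.ofReal (3 * (A n * ((5 : ℝ) ^ n) ^ (α : ℝ))) := fun n t ht =>
    cHolderNorm_le_of_scale hα.le (hA n) (hnorm n t ht) (hlip n t ht)
  refine ⟨hper, fun t ht => ?_, fun s hs => ?_⟩
  · rcases eq_or_lt_of_le ht.2 with rfl | hlt
    · simp [hone, cHolderNorm_zero]
    · obtain ⟨n, hn⟩ := exists_mem_epoch ⟨ht.1, hlt⟩
      exact (hbound n t hn).trans_lt ENNReal.ofReal_lt_top
  · rcases eq_or_lt_of_le hs.2 with rfl | hlt
    · simp only [hone, sub_zero]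
      have h3 := (ENNReal.continuous_ofReal.tendsto _).comp (hlim.const_mul 3)
      rw [mul_zero, ENNReal.ofReal_zero] at h3
      rw [ENNReal.tendsto_nhds_zero] at h3 ⊢
      intro ε hε
      obtain ⟨N, hN⟩ := eventually_atTop.1 (h3 ε hε)
      filter_upwards [eventually_exists_mem_epoch N] with t ht
      rcases ht with rfl | ⟨n, hn, ht⟩
      · simp [hone, cHolderNorm_zero]
      · exact (hbound n t ht).trans (hN n hn)
    · have hs' : s ∈ Ico (0 : ℝ) 1 := ⟨hs.1, hlt⟩
      obtain ⟨N, hN⟩ := exists_lt_tn hlt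
      -- Times before `t_N` lie in epochs with index below `N`, so the sum of their Lipschitz
      -- constants serves for all of them.
      have hB : ∀ t ∈ Ico (0 : ℝ) 1, t < tn N → ∀ x y,
          ‖f x t - f y t‖ ≤ (∑ n ∈ Finset.range N, A n * 5 ^ n) * ‖x - y‖ := by
        intro t ht htN x y
        obtain ⟨n, hn⟩ := exists_mem_Ico_tn ht
        have hnN : n ∈ Finset.range N :=
          Finset.mem_range.2 (strictMono_tn.lt_iff_lt.1 (hn.1.trans_lt htN))
        refine (hlip n t (Ico_subset_Icc_self hn) x y).trans
          (mul_le_mul_of_nonneg_right ?_ (norm_nonneg _))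
        exact Finset.single_le_sum (f := fun n => A n * (5 : ℝ) ^ n)
          (fun k _ => mul_nonneg (hA k) (by positivity)) hnN
      refine tendsto_cHolderNorm_zero hα (B := 2 * ∑ n ∈ Finset.range N, A n * 5 ^ n) ?_ ?_
      · filter_upwards [self_mem_nhdsWithin, mem_nhdsWithin_of_mem_nhds (Iio_mem_nhds hN)]
          with t ht htN x y
        have h1 := hB t ⟨ht.1, lt_trans htN (tn_lt_one N)⟩ htN x y
        have h2 := hB s hs' hN x y
        have h3 : f x t - f x s - (f y t - f y s) = (f x t - f y t) - (f x s - f y s) := by abel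
        rw [h3]
        linarith [norm_sub_le (f x t - f y t) (f x s - f y s)]
      · intro ε hε
        refine eventually_of_epochs hs' fun n hn => ?_
        filter_upwards [Metric.tendstoUniformly_iff.1 (hcont n s hn) ε hε] with t ht x
        rw [← dist_eq_norm, dist_comm]
        exact (ht x).le

theorem memCTimeHolder_nsForce (hη : IsTimeChange η) (hw : IsControlledFamily M D w) (hM : 0 ≤ M)
    (hD : ∀ n, 0 ≤ D n) (ν : ℝ) (hα : α < 1)
    (hlim : Tendsto (fun n : ℕ => ((n : ℝ) + 1) ^ 16 * (M / 5 ^ n + |ν| * D n) *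
      ((5 : ℝ) ^ n) ^ (α : ℝ)) atTop (𝓝 0)) :
    MemCTimeHolder α (nsForce ν (velocity w η)) := by
  obtain ⟨K, hK0, hK⟩ := hη.exists_epochForce_bounds
  have hK := hK w M D hM hD hw ν
  refine memCTimeHolder_of_epochs hα (A := fun n => K * ((n : ℝ) + 1) ^ 16 *
    (M / 5 ^ n + |ν| * D n)) (fun t ht => hw.periodic_nsForce hη ν ht)
    (hw.nsForce_velocity_one hη ν) (fun n => ?_) (fun n t ht x => ?_) (fun n t ht x y => ?_)
    (fun n s hs => hw.tendstoUniformly_nsForce hη ν hs) ?_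
  · have := hD n
    positivity
  · rw [nsForce_velocity_eq hη hw.smooth ν ht]
    exact (hK n t ht).1 x
  · rw [nsForce_velocity_eq hη hw.smooth ν ht, nsForce_velocity_eq hη hw.smooth ν ht]
    exact (hK n t ht).2.1 x y
  · simpa [mul_assoc] using hlim.const_mul K

theorem cTimeHolderNorm_le {f : Plane → ℝ → Plane} {b : ENNReal} (hone : ∀ x, f x 1 = 0)
    (h : ∀ n, ∀ t ∈ epoch n, cHolderNorm α (fun x => f x t) ≤ b) : cTimeHolderNorm α f ≤ b := by
  refine iSup₂_le fun t ht => ?_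
  rcases eq_or_lt_of_le ht.2 with rfl | hlt
  · simp [hone, cHolderNorm_zero]
  · obtain ⟨n, hn⟩ := exists_mem_epoch ⟨ht.1, hlt⟩
    exact h n t hn

/-- The Laplacian bound is cut off along with the field. This matters because `ν_m 5 ^ n` times the
Hölder factor is unbounded as `n → ∞` for fixed `m`. -/
theorem IsControlledFamily.trunc (hw : IsControlledFamily M D w) (hM : 0 ≤ M) (m : ℕ) :
    IsControlledFamily M (fun n => if n ≤ m then D n else 0)
      (fun n x t => if n ≤ m then w n x t else 0) := by
  have hz : ∀ R, Controlled (0 : ℝ) R (eulerForce fun _ _ => 0) := fun R => by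
    have h : eulerForce (fun _ _ => 0) = fun _ _ => 0 := by
      funext x t
      simp [eulerForce]
    rw [h]
    exact controlled_zero
  refine ⟨fun n => ?_, fun n => ?_, fun n => ?_, fun n => ?_⟩ <;> by_cases hn : n ≤ m <;>
    simp only [hn, if_true, if_false]
  · exact hw.smooth n
  · exact .of_contDiffOn contDiffOn_const
  · exact hw.self n
  · exact controlled_zero.mono (by positivity) (by positivity)
  · exact hw.euler n
  · exact (hz _).mono (by positivity) (by positivity)
  · exact hw.laplacian n
  · simp only [InnerProductSpace.laplacian_const]
    exact controlled_zero

/-- The amplitude `(n + 1) ^ 26 · 5 ^ (-(1 - α) n)` to which the forces are compared. -/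
noncomputable def decay (α : ℝ≥0) (n : ℕ) : ℝ :=
  ((n : ℝ) + 1) ^ 26 * ((5 : ℝ) ^ ((α : ℝ) - 1)) ^ n

theorem decay_nonneg (n : ℕ) : 0 ≤ decay α n := by
  unfold decay
  positivity

theorem tendsto_decay (hα : α < 1) : Tendsto (decay α) atTop (𝓝 0) :=
  tendsto_pow_mul_geometric 26 (by positivity)
    (Real.rpow_lt_one_of_one_lt_of_neg (by norm_num) (sub_neg.2 (by exact_mod_cast hα)))

theorem rpow_eq_pow_mul (n : ℕ) :
    ((5 : ℝ) ^ n) ^ (α : ℝ) = 5 ^ n * ((5 : ℝ) ^ ((α : ℝ) - 1)) ^ n := by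
  rw [← mul_pow, Real.rpow_sub_one (by norm_num), mul_div_cancel₀ _ (by norm_num),
    ← Real.rpow_natCast, ← Real.rpow_natCast, ← Real.rpow_mul (by norm_num),
    ← Real.rpow_mul (by norm_num), mul_comm]

/-- The amplitude `5 ^ (-n)` against the Hölder cost `5 ^ (α n)` leaves `5 ^ (-(1 - α) n)`. The
exponent `16` is enlarged to `26` only to share `decay` with the viscous term. -/
theorem inertial_le (hM : 0 ≤ M) (n : ℕ) :
    ((n : ℝ) + 1) ^ 16 * (M / 5 ^ n) * ((5 : ℝ) ^ n) ^ (α : ℝ) ≤ M * decay α n := by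
  have hn : (1 : ℝ) ≤ (n : ℝ) + 1 := by linarith [n.cast_nonneg (α := ℝ)]
  rw [rpow_eq_pow_mul, decay]
  calc _ = M * (((n : ℝ) + 1) ^ 16 * ((5 : ℝ) ^ ((α : ℝ) - 1)) ^ n) := by field_simp
    _ ≤ _ := by
      refine mul_le_mul_of_nonneg_left (mul_le_mul_of_nonneg_right ?_ (by positivity)) hM
      exact pow_le_pow_right₀ hn (by norm_num)

theorem viscosity_nonneg (m : ℕ) : 0 ≤ viscosity m := by
  unfold viscosity
  positivity

/-- The geometric factor `(25 · 5 ^ (α - 1)) ^ n` has base at least `1`, so the worst epoch is `n =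
m`, where `25 ^ m` cancels against the viscosity. The exponent `26` is `16` from the time change
plus `10` from the viscosity. -/
theorem viscous_le (hM : 0 ≤ M) {n m : ℕ} (hnm : n ≤ m) :
    ((n : ℝ) + 1) ^ 16 * (|viscosity m| * (M * 5 ^ n)) * ((5 : ℝ) ^ n) ^ (α : ℝ) ≤
      M * decay α m := by
  have hq : 0 < (5 : ℝ) ^ ((α : ℝ) - 1) := by positivity
  have hq1 : 1 ≤ 25 * (5 : ℝ) ^ ((α : ℝ) - 1) := by
    rw [Real.rpow_sub_one (by norm_num)]
    have : 1 ≤ (5 : ℝ) ^ (α : ℝ) := Real.one_le_rpow (by norm_num) α.coe_nonneg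
    linarith
  have hmono : (25 * (5 : ℝ) ^ ((α : ℝ) - 1)) ^ n ≤ (25 * (5 : ℝ) ^ ((α : ℝ) - 1)) ^ m :=
    pow_le_pow_right₀ hq1 hnm
  have hnm' : (n : ℝ) ≤ m := by exact_mod_cast hnm
  have h25 : ∀ k : ℕ, (25 : ℝ) ^ k = 5 ^ k * 5 ^ k := fun k => by rw [← mul_pow]; norm_num
  rw [rpow_eq_pow_mul, abs_of_nonneg (viscosity_nonneg m), viscosity, decay, pow_mul]
  norm_num only
  calc _ = M * (((n : ℝ) + 1) ^ 16 * (m : ℝ) ^ 10 *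
        (25 * (5 : ℝ) ^ ((α : ℝ) - 1)) ^ n / 25 ^ m) := by
        rw [mul_pow, h25 n]
        ring
    _ ≤ M * (((m : ℝ) + 1) ^ 16 * ((m : ℝ) + 1) ^ 10 *
        (25 * (5 : ℝ) ^ ((α : ℝ) - 1)) ^ m / 25 ^ m) := by
        gcongr
        linarith
    _ = _ := by
        rw [mul_pow]
        field_simp

end Forces

end QuasiSelfSimilar

/-! ### Assembly of the lemma -/

theorem mainTheorem7
    (ρ : ℕ → QuasiSelfSimilar.Plane → ℝ → ℝ)
    (v : ℕ → QuasiSelfSimilar.Plane → ℝ → QuasiSelfSimilar.Plane)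
    (hv : QuasiSelfSimilar.IsQuasiSelfSimilarFamily ρ v)
    (η : ℝ → ℝ) (hη : QuasiSelfSimilar.IsTimeChange η) :
    (∀ m : ℕ, 2 ≤ m →
      QuasiSelfSimilar.HasClassicalDerivatives (QuasiSelfSimilar.velocityTrunc v η m)) ∧
    QuasiSelfSimilar.HasClassicalDerivatives (QuasiSelfSimilar.velocity v η) ∧
    ∀ α : ℝ≥0, 0 < α → α < 1 →
      (∀ m : ℕ, 2 ≤ m → QuasiSelfSimilar.MemCTimeHolder α
        (QuasiSelfSimilar.nsForce (QuasiSelfSimilar.viscosity m)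
          (QuasiSelfSimilar.velocityTrunc v η m))) ∧
      (∃ C : ℝ≥0, ∀ m : ℕ, 2 ≤ m → QuasiSelfSimilar.cTimeHolderNorm α
        (QuasiSelfSimilar.nsForce (QuasiSelfSimilar.viscosity m)
          (QuasiSelfSimilar.velocityTrunc v η m)) ≤ (C : ENNReal)) ∧
      QuasiSelfSimilar.MemCTimeHolder α
        (QuasiSelfSimilar.eulerForce (QuasiSelfSimilar.velocity v η)) ∧
      Tendsto
        (fun m : ℕ => QuasiSelfSimilar.cTimeHolderNorm α fun x t =>
          QuasiSelfSimilar.nsForce (QuasiSelfSimilar.viscosity m)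
              (QuasiSelfSimilar.velocityTrunc v η m) x t -
            QuasiSelfSimilar.eulerForce (QuasiSelfSimilar.velocity v η) x t)
        atTop (𝓝 0) := by
  open QuasiSelfSimilar in
  obtain ⟨M, hM, hw⟩ := hv.exists_isControlledFamily
  have hwm := fun m => hw.trunc hM m
  have hD : ∀ n : ℕ, 0 ≤ M * 5 ^ n := fun n => by positivity
  have hDm : ∀ m n : ℕ, 0 ≤ if n ≤ m then M * (5 : ℝ) ^ n else 0 := fun m n => by
    split_ifs
    · exact hD n
    · exact le_rfl
  obtain ⟨K, hK0, hK⟩ := hη.exists_epochForce_bounds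
  simp only [velocityTrunc_eq_velocity, ← nsForce_zero (velocity v η)]
  refine ⟨fun m _ => (hwm m).hasClassicalDerivatives hη, hw.hasClassicalDerivatives hη,
    fun α _ hα => ⟨fun m _ => ?_, ?_, ?_, ?_⟩⟩
  · refine memCTimeHolder_nsForce hη (hwm m) hM (hDm m) _ hα ?_
    have h := (tendsto_decay hα).const_mul M
    rw [mul_zero] at h
    refine squeeze_zero' (Eventually.of_forall fun n => ?_) ?_ h
    · have := hDm m n
      positivity
    -- Only epochs near `t = 1` matter for the limit, and for `n > m` the viscous part is zero.
    · filter_upwards [eventually_gt_atTop m] with n hn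
      simpa [hn.not_ge] using inertial_le (α := α) hM n
  · obtain ⟨B, hB⟩ := (tendsto_decay hα).bddAbove_range
    have hB : ∀ n, decay α n ≤ B := fun n => hB (mem_range_self n)
    -- The factor `3` is the one in `cHolderNorm_le_of_scale`; the factor `2` counts the inertial
    -- and viscous parts, each at most `M * B`.
    refine ⟨(3 * (K * (2 * (M * B)))).toNNReal, fun m _ => cTimeHolderNorm_le
      ((hwm m).nsForce_velocity_one hη _) fun n t ht => ?_⟩
    obtain ⟨h1, h2, -, -⟩ := hK _ M _ hM (hDm m) (hwm m) (viscosity m) n t ht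
    simp only [nsForce_velocity_eq hη (hwm m).smooth _ ht]
    have := hDm m n
    refine (cHolderNorm_le_of_scale hα.le (by positivity) h1 h2).trans
      (ENNReal.ofReal_le_ofReal ?_)
    have h3 := inertial_le (α := α) hM n
    have h4 : ((n : ℝ) + 1) ^ 16 * (|viscosity m| * if n ≤ m then M * 5 ^ n else 0) *
        ((5 : ℝ) ^ n) ^ (α : ℝ) ≤ M * B := by
      split_ifs with hnm
      · exact (viscous_le hM hnm).trans (mul_le_mul_of_nonneg_left (hB m) hM)
      · simpa using mul_nonneg hM ((decay_nonneg 0).trans (hB 0))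
    have h5 := h3.trans (mul_le_mul_of_nonneg_left (hB n) hM)
    have h6 := mul_le_mul_of_nonneg_left (add_le_add h5 h4) hK0
    calc _ = 3 * (K * (((n : ℝ) + 1) ^ 16 * (M / 5 ^ n) * ((5 : ℝ) ^ n) ^ (α : ℝ) +
          ((n : ℝ) + 1) ^ 16 * (|viscosity m| * if n ≤ m then M * 5 ^ n else 0) *
          ((5 : ℝ) ^ n) ^ (α : ℝ))) := by ring
      _ ≤ 3 * (K * (M * B + M * B)) := by linarith
      _ = _ := by ring
  · refine memCTimeHolder_nsForce hη hw hM hD 0 hα ?_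
    have h := (tendsto_decay hα).const_mul M
    rw [mul_zero] at h
    refine squeeze_zero (fun n => by positivity) (fun n => ?_) h
    simpa using inertial_le (α := α) hM n
  · have hlim := ((tendsto_decay hα).const_mul M).const_mul (3 * K)
    simp only [mul_zero] at hlim
    rw [ENNReal.tendsto_nhds_zero]
    intro ε hε
    have hlim := (ENNReal.continuous_ofReal.tendsto _).comp hlim
    rw [ENNReal.ofReal_zero, ENNReal.tendsto_nhds_zero] at hlim
    obtain ⟨N, hN⟩ := eventually_atTop.1 (hlim ε hε)
    filter_upwards [eventually_ge_atTop N] with m hm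
    refine cTimeHolderNorm_le (fun x => by
      rw [(hwm m).nsForce_velocity_one hη, hw.nsForce_velocity_one hη, sub_zero]) fun n t ht => ?_
    simp only [nsForce_velocity_eq hη (hwm m).smooth _ ht, nsForce_velocity_eq hη hw.smooth _ ht]
    -- Up to epoch `m` the two velocities coincide and only the viscous term survives, with size
    -- governed by `decay α m`. Afterwards the truncated field is zero and what remains is `-g`,
    -- governed by `decay α n` with `n > m ≥ N`.
    by_cases hnm : n ≤ m
    · obtain ⟨-, -, h1, h2⟩ := hK _ M _ hM hD hw (viscosity m) n t ht
      have heq : ∀ x, epochForce (viscosity m) (fun n x t => if n ≤ m then v n x t else 0) η n x t -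
          epochForce 0 v η n x t = -((viscosity m * rate η n t) •
            Laplacian.laplacian (fun z => v n z (phase η n t)) x) := fun x => by
        simp only [epochForce, hnm, if_true, zero_mul, zero_smul]
        abel
      simp only [heq]
      refine (cHolderNorm_le_of_scale (n := n) hα.le (by positivity)
        (fun x => (norm_neg _).trans_le (h1 x)) fun x y => ?_).trans
        ((ENNReal.ofReal_le_ofReal ?_).trans (hN m hm))
      · rw [neg_sub_neg, norm_sub_rev]
        exact h2 x y
      · have h3 := mul_le_mul_of_nonneg_left (viscous_le (α := α) hM hnm)
          (show 0 ≤ 3 * K by positivity)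
        refine le_trans (le_of_eq ?_) h3
        ring
    · obtain ⟨h1, h2, -, -⟩ := hK _ M _ hM hD hw 0 n t ht
      have heq : ∀ x, epochForce (viscosity m) (fun n x t => if n ≤ m then v n x t else 0) η n x t -
          epochForce 0 v η n x t = -epochForce 0 v η n x t := fun x => by
        rw [sub_eq_neg_self]
        simp [epochForce, hnm, eulerForce]
      simp only [heq]
      refine (cHolderNorm_le_of_scale (n := n) hα.le (by positivity)
        (fun x => (norm_neg _).trans_le (h1 x)) fun x y => ?_).trans
        ((ENNReal.ofReal_le_ofReal ?_).trans (hN n (by omega)))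
      · rw [neg_sub_neg, norm_sub_rev]
        exact h2 x y
      · have h3 := mul_le_mul_of_nonneg_left (inertial_le (α := α) hM n)
          (show 0 ≤ 3 * K by positivity)
        refine le_trans (le_of_eq ?_) h3
        rw [abs_zero, zero_mul, add_zero]
        ring
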